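/- Let $\rho:\mathbb R\to\mathbb R$ be four times continuously differentiable with $\sup_z|\rho^{(k)}(z)|<\infty$ for $k=1,2,3,4$, and suppose that the activation $\rho'$ takes values in $[0,1]$, is nondecreasing and not constant, and is symmetric: $\rho'(z)+\rho'(-z)=1$ for all $z$. Let $\gamma>0$. For $\lambda>0$ let $\mathrm{prox}_{\lambda\rho}(z)=\operatorname{argmin}_t\{\lambda\rho(t)+\tfrac12(t-z)^2\}$. For $\kappa>0$ consider the system in $(\alpha,\sigma,\lambda)$ $$\sigma^2=\frac1{\kappa^2}\,\mathbb E\big[2\rho'(Q_1)\,\lambda^2\rho'(\mathrm{prox}_{\lambda\rho}(Q_2))^2\big],\qquad 0=\mathbb E\big[\rho'(Q_1)\,Q_1\,\lambda\rho'(\mathrm{prox}_{\lambda\rho}(Q_2))\big],\qquad 1-\kappa=\mathbb E\Big[\frac{2\rho'(Q_1)}{1+\lambda\rho''(\mathrm{prox}_{\lambda\rho}(Q_2))}\Big],$$ where $(Q_1,Q_2)$ is a centered bivariate normal vector with covariance matrix $\begin{bmatrix}\gamma^2&-\alpha\gamma^2\\-\alpha\gamma^2&\alpha^2\gamma^2+\kappa\sigma^2\end{bmatrix}$.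 With $Q_1\sim N(0,\gamma^2)$ define $$\bar\alpha_0=-\frac{\mathbb E[Q_1\rho'''(Q_1)]\,\mathbb E[\rho'(Q_1)\rho'(-Q_1)]}{2\,\mathbb E[Q_1^2\rho''(Q_1)]\,\mathbb E[\rho''(Q_1)]^2},\qquad \bar\sigma_0^2=\frac{\mathbb E[\rho'(Q_1)\rho'(-Q_1)]}{\mathbb E[\rho''(Q_1)]^2},\qquad \bar\lambda_0=\frac1{\mathbb E[\rho''(Q_1)]}.$$ Then $\mathbb E[Q_1^2\rho''(Q_1)]>0$, $\bar\sigma_0^2>0$ and $\bar\lambda_0>0$, so these constants are well defined (with $\bar\sigma_0>0$ the square root of $\bar\sigma_0^2$). Moreover, there is $\kappa_0=\kappa_0(\rho,\gamma)>0$ such that for every $\kappa\in(0,\kappa_0]$ the system has exactly one solution $(\alpha_\star(\kappa),\sigma_\star(\kappa),\lambda_\star(\kappa))$ with $\alpha>0$, $\sigma>0$, $\lambda>0$, and, as $\kappa\to0^+$, $$\alpha_\star(\kappa)=1+\bar\alpha_0\kappa+o(\kappa),\qquad \sigma_\star(\kappa)=\bar\sigma_0+o(1),\qquad \lambda_\star(\kappa)=\bar\lambda_0\kappa+o(\kappa).$$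 -/

import Mathlib

open MeasureTheory ProbabilityTheory Filter Topology Asymptotics

noncomputable section

/-- The standing assumption on the loss `ρ`, phrased through the activation `ρ' = deriv ρ`:
the activation is `[0,1]`-valued, nondecreasing, not constant and symmetric
(`ρ' - 1/2` is odd), and `ρ` is four times continuously differentiable with bounded derivatives of
orders one to four. -/
structure IsActivationLoss (ρ : ℝ → ℝ) : Prop where
  contDiff : ContDiff ℝ 4 ρ
  bounded : ∀ k : ℕ, 1 ≤ k → k ≤ 4 → ∃ C : ℝ, ∀ z : ℝ, |iteratedDeriv k ρ z| ≤ C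
  mem_unit : ∀ z : ℝ, 0 ≤ deriv ρ z ∧ deriv ρ z ≤ 1
  monotone : Monotone (deriv ρ)
  nonconstant : ∃ y z : ℝ, deriv ρ y ≠ deriv ρ z
  symmetric : ∀ z : ℝ, deriv ρ z + deriv ρ (-z) = 1

/-- The proximal operator `prox_{lam ρ}(z) = argmin_t { lam ρ(t) + (t - z)² / 2 }`; for convex
`ρ` and `lam > 0`, as below, the minimizer exists and is unique. -/
def prox (lam : ℝ) (ρ : ℝ → ℝ) (z : ℝ) : ℝ :=
  Classical.epsilon fun x : ℝ => IsMinOn (fun t : ℝ => lam * ρ t + (t - z) ^ 2 / 2) Set.univ x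

/-- The covariance matrix of `(Q₁, Q₂)`. -/
def covQ (γ κ α σ : ℝ) : Matrix (Fin 2) (Fin 2) ℝ :=
  !![γ ^ 2, -α * γ ^ 2; -α * γ ^ 2, α ^ 2 * γ ^ 2 + κ * σ ^ 2]

/-- The centered bivariate normal law of `(Q₁, Q₂)`. -/
def lawQ (γ κ α σ : ℝ) : Measure (EuclideanSpace ℝ (Fin 2)) :=
  multivariateGaussian 0 (covQ γ κ α σ)

/-- The system of three fixed-point equations for `(α, σ, lam)`. -/
def SolvesSystem (ρ : ℝ → ℝ) (γ κ α σ lam : ℝ) : Prop :=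
  σ ^ 2 = 1 / κ ^ 2 *
      ∫ Q, 2 * deriv ρ (Q 0) * (lam ^ 2 * deriv ρ (prox lam ρ (Q 1)) ^ 2) ∂lawQ γ κ α σ ∧
  0 = ∫ Q, deriv ρ (Q 0) * Q 0 * (lam * deriv ρ (prox lam ρ (Q 1))) ∂lawQ γ κ α σ ∧
  1 - κ = ∫ Q, 2 * deriv ρ (Q 0) /
      (1 + lam * iteratedDeriv 2 ρ (prox lam ρ (Q 1))) ∂lawQ γ κ α σ

/-- Expectation of `f(Q₁)` for `Q₁ ∼ N(0, γ²)`. -/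
def gaussE (γ : ℝ) (f : ℝ → ℝ) : ℝ :=
  ∫ q, f q ∂gaussianReal 0 (Real.toNNReal (γ ^ 2))

def alphaBar (ρ : ℝ → ℝ) (γ : ℝ) : ℝ :=
  -(gaussE γ (fun q => q * iteratedDeriv 3 ρ q) * gaussE γ (fun q => deriv ρ q * deriv ρ (-q))) /
    (2 * gaussE γ (fun q => q ^ 2 * iteratedDeriv 2 ρ q) *
      gaussE γ (fun q => iteratedDeriv 2 ρ q) ^ 2)

def sigmaBarSq (ρ : ℝ → ℝ) (γ : ℝ) : ℝ :=
  gaussE γ (fun q => deriv ρ q * deriv ρ (-q)) / gaussE γ (fun q => iteratedDeriv 2 ρ q) ^ 2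

def lambdaBar (ρ : ℝ → ℝ) (γ : ℝ) : ℝ :=
  1 / gaussE γ (fun q => iteratedDeriv 2 ρ q)

end

/-! Write `Q₂ = -α Q₁ + s Z` with `s = √κ σ` and `Z` standard normal, independent of `Q₁`, and let
`H = ρ'(prox(Q₂))`, the gradient of the Moreau envelope. The system becomes `A = 0`, `κ s² = l² B`,
`κ = l C`, where `A`, `B`, `C` (`corrInt`, `energyInt`, `slopeInt`) depend continuously on `(α, s,
l)`, even at the degenerate point `(1, 0, 0)`.

Uniqueness holds for every `κ > 0`. For two solutions, monotonicity of `ρ'` makes `E[2ρ'(Q₁)(H -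
H')(prox - prox')]` nonnegative, and so is the weighted square of `l s' H - l' s H'`. Integration by
parts, `E[2ρ'(Q₁) Z H] = s C`, and the equations turn a positive combination of the two into `(s
s')² (κ - κ')(l - l')`. If this is not positive, both integrands vanish and the parameters agree
(`eq_of_reducedSystem`). Equal `κ` gives uniqueness; equal `l` gives uniqueness along a curve
parametrized by `l`.

Existence uses the intermediate value theorem three times. Put `s² = l t`; the last two equations
reduce to `t C = B` and `κ = l C`. For fixed small `l`, one solves `A = 0` for `α`, where `A` is
strictly decreasing, then `t C = B` for `t`. Uniqueness at fixed `l` makes `l ↦ (α, t)` continuous,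
so `κ = l C` takes all small positive values. The limits of `σ² = t/C` and `l/κ = 1/C` are values at
the degenerate point.

For `α`, expand `A = 0` to order `κ`. The term linear in `Z` has mean zero and the first-order
effect of `l` is odd in `Q₁`; what remains is `-(α - 1) E[Q₁² ρ''(Q₁)]/2 - κ σ² E[Q₁ ρ'''(Q₁)]/4`.
-/

namespace IsActivationLoss

variable {ρ : ℝ → ℝ}

/-! ### Elementary properties of the activation -/

lemma hasDerivAt (hρ : IsActivationLoss ρ) (x : ℝ) : HasDerivAt ρ (deriv ρ x) x :=
  (hρ.contDiff.differentiable (by norm_num) x).hasDerivAt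

lemma continuous_iteratedDeriv (hρ : IsActivationLoss ρ) {k : ℕ} (hk : k ≤ 4) :
    Continuous (iteratedDeriv k ρ) :=
  hρ.contDiff.continuous_iteratedDeriv k (by exact_mod_cast hk)

lemma hasDerivAt_iteratedDeriv (hρ : IsActivationLoss ρ) {k : ℕ} (hk : k < 4) (x : ℝ) :
    HasDerivAt (iteratedDeriv k ρ) (iteratedDeriv (k + 1) ρ x) x := by
  rw [iteratedDeriv_succ]
  exact (hρ.contDiff.differentiable_iteratedDeriv k (by exact_mod_cast hk) x).hasDerivAt

lemma hasDerivAt_deriv (hρ : IsActivationLoss ρ) (x : ℝ) :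
    HasDerivAt (deriv ρ) (iteratedDeriv 2 ρ x) x := by
  simpa only [iteratedDeriv_one] using hρ.hasDerivAt_iteratedDeriv (k := 1) (by norm_num) x

lemma continuous_deriv (hρ : IsActivationLoss ρ) : Continuous (deriv ρ) :=
  continuous_iff_continuousAt.2 fun x => (hρ.hasDerivAt_deriv x).continuousAt

lemma continuous_deriv_two (hρ : IsActivationLoss ρ) : Continuous (iteratedDeriv 2 ρ) :=
  hρ.continuous_iteratedDeriv (by norm_num)

lemma continuous_deriv_three (hρ : IsActivationLoss ρ) : Continuous (iteratedDeriv 3 ρ) :=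
  hρ.continuous_iteratedDeriv (by norm_num)

lemma deriv_two_nonneg (hρ : IsActivationLoss ρ) (x : ℝ) : 0 ≤ iteratedDeriv 2 ρ x := by
  rw [← (hρ.hasDerivAt_deriv x).deriv]
  exact hρ.monotone.deriv_nonneg

lemma deriv_neg (hρ : IsActivationLoss ρ) (x : ℝ) : deriv ρ (-x) = 1 - deriv ρ x := by
  linarith [hρ.symmetric x]

lemma deriv_two_neg (hρ : IsActivationLoss ρ) (x : ℝ) :
    iteratedDeriv 2 ρ (-x) = iteratedDeriv 2 ρ x := by
  have h1 : HasDerivAt (fun y => deriv ρ (-y)) (-iteratedDeriv 2 ρ (-x)) x := by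
    rw [← mul_neg_one]
    exact (hρ.hasDerivAt_deriv (-x)).comp x (hasDerivAt_neg x)
  have h2 : HasDerivAt (fun y => deriv ρ (-y)) (-iteratedDeriv 2 ρ x) x := by
    have : (fun y => deriv ρ (-y)) = fun y => 1 - deriv ρ y := funext hρ.deriv_neg
    rw [this]
    exact (hρ.hasDerivAt_deriv x).const_sub 1
  linarith [h1.unique h2]

lemma deriv_three_neg (hρ : IsActivationLoss ρ) (x : ℝ) :
    iteratedDeriv 3 ρ (-x) = -iteratedDeriv 3 ρ x := by
  have h1 : HasDerivAt (fun y => iteratedDeriv 2 ρ (-y)) (-iteratedDeriv 3 ρ (-x)) x := by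
    rw [← mul_neg_one]
    exact (hρ.hasDerivAt_iteratedDeriv (k := 2) (by norm_num) (-x)).comp x (hasDerivAt_neg x)
  have h2 : HasDerivAt (fun y => iteratedDeriv 2 ρ (-y)) (iteratedDeriv 3 ρ x) x := by
    have : (fun y => iteratedDeriv 2 ρ (-y)) = iteratedDeriv 2 ρ := funext hρ.deriv_two_neg
    rw [this]
    exact hρ.hasDerivAt_iteratedDeriv (k := 2) (by norm_num) x
  linarith [h1.unique h2]

lemma deriv_zero (hρ : IsActivationLoss ρ) : deriv ρ 0 = 1 / 2 := by
  have := hρ.symmetric 0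
  rw [neg_zero] at this
  linarith

/-- Monotonicity and `ρ'(0) = 1/2`. The activation may vanish on part of the negative axis, so later
pointwise conclusions are drawn only for `q > 0`. -/
lemma deriv_pos_of_nonneg (hρ : IsActivationLoss ρ) {x : ℝ} (hx : 0 ≤ x) : 0 < deriv ρ x := by
  have := hρ.monotone hx
  rw [hρ.deriv_zero] at this
  linarith

lemma exists_bound_two (hρ : IsActivationLoss ρ) :
    ∃ M : ℝ, 0 ≤ M ∧ ∀ x, |iteratedDeriv 2 ρ x| ≤ M := by
  obtain ⟨C, hC⟩ := hρ.bounded 2 (by norm_num) (by norm_num)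
  exact ⟨C, (abs_nonneg _).trans (hC 0), hC⟩

lemma exists_bound_three (hρ : IsActivationLoss ρ) :
    ∃ M : ℝ, 0 ≤ M ∧ ∀ x, |iteratedDeriv 3 ρ x| ≤ M := by
  obtain ⟨C, hC⟩ := hρ.bounded 3 (by norm_num) (by norm_num)
  exact ⟨C, (abs_nonneg _).trans (hC 0), hC⟩

/-- The activation is not invariant under any nontrivial positive dilation. -/
lemma dilation_eq_one (hρ : IsActivationLoss ρ) {c : ℝ} (hc : 0 < c)
    (h : ∀ x, deriv ρ (c * x) = deriv ρ x) : c = 1 := by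
  have key : ∀ c : ℝ, 0 < c → c < 1 → ¬ ∀ x, deriv ρ (c * x) = deriv ρ x := by
    intro c hc hc1 h
    -- Iterating the invariance contracts every point to `0`, so continuity would make the
    -- activation constant.
    have hpow : ∀ x, ∀ n : ℕ, deriv ρ (c ^ n * x) = deriv ρ x := by
      intro x n
      induction n with
      | zero => simp
      | succ n ih => rw [pow_succ', mul_assoc, h, ih]
    have hconst : ∀ x, deriv ρ x = deriv ρ 0 := by
      intro x
      have h1 : Tendsto (fun n : ℕ => deriv ρ (c ^ n * x)) atTop (𝓝 (deriv ρ (0 * x))) :=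
        (hρ.continuous_deriv.tendsto _).comp
          ((tendsto_pow_atTop_nhds_zero_of_lt_one hc.le hc1).mul_const x)
      simp only [hpow, zero_mul] at h1
      exact tendsto_nhds_unique tendsto_const_nhds h1
    obtain ⟨y, z, hyz⟩ := hρ.nonconstant
    exact hyz ((hconst y).trans (hconst z).symm)
  rcases lt_trichotomy c 1 with h1 | h1 | h1
  · exact absurd h (key c hc h1)
  · exact h1
  · refine absurd (fun x => ?_) (key c⁻¹ (inv_pos.2 hc) (inv_lt_one_of_one_lt₀ h1))
    rw [← h (c⁻¹ * x), mul_inv_cancel_left₀ hc.ne']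

/-! ### The proximal operator -/

lemma strictMono_add_mul_deriv (hρ : IsActivationLoss ρ) {l : ℝ} (hl : 0 ≤ l) :
    StrictMono fun t => t + l * deriv ρ t :=
  strictMono_id.add_monotone (hρ.monotone.const_mul hl)

lemma exists_add_mul_deriv_eq (hρ : IsActivationLoss ρ) {l : ℝ} (hl : 0 ≤ l) (z : ℝ) :
    ∃ p, p + l * deriv ρ p = z := by
  have hc : Continuous fun t => t + l * deriv ρ t :=
    continuous_id.add (continuous_const.mul hρ.continuous_deriv)
  have h1 : z - l + l * deriv ρ (z - l) ≤ z := by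
    nlinarith [(hρ.mem_unit (z - l)).2]
  have h2 : z ≤ z + l * deriv ρ z := by
    nlinarith [(hρ.mem_unit z).1]
  obtain ⟨p, -, hp⟩ := intermediate_value_Icc (by linarith : z - l ≤ z) hc.continuousOn ⟨h1, h2⟩
  exact ⟨p, hp⟩

/-- The objective is convex with derivative `t + l ρ'(t) - z`, so stationarity is both necessary and
sufficient. -/
lemma isMinOn_prox_objective_iff (hρ : IsActivationLoss ρ) {l : ℝ} (hl : 0 ≤ l) (z p : ℝ) :
    IsMinOn (fun t : ℝ => l * ρ t + (t - z) ^ 2 / 2) Set.univ p ↔ p + l * deriv ρ p = z := by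
  have hd : ∀ t, HasDerivAt (fun t : ℝ => l * ρ t + (t - z) ^ 2 / 2)
      (t + l * deriv ρ t - z) t := by
    intro t
    have := ((hρ.hasDerivAt t).const_mul l).add ((((hasDerivAt_id t).sub_const z).pow 2).div_const 2)
    refine this.congr_deriv ?_
    simp only [id]
    push_cast
    ring
  have hdd : deriv (fun t : ℝ => l * ρ t + (t - z) ^ 2 / 2) = fun t => t + l * deriv ρ t - z :=
    funext fun t => (hd t).deriv
  constructor
  · intro h
    have := (h.isLocalMin univ_mem).hasDerivAt_eq_zero (hd p)
    linarith
  · intro h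
    have hconv : ConvexOn ℝ Set.univ (fun t : ℝ => l * ρ t + (t - z) ^ 2 / 2) := by
      refine Monotone.convexOn_univ_of_deriv (fun t => (hd t).differentiableAt) ?_
      rw [hdd]
      exact fun a b hab => sub_le_sub_right ((hρ.strictMono_add_mul_deriv hl).monotone hab) z
    refine IsMinOn.of_isLocalMinOn_of_convexOn (Set.mem_univ p) ?_ hconv
    refine IsLocalMin.on ?_ _
    have hp0 : p + l * deriv ρ p - z = 0 := by linarith
    refine isLocalMin_of_deriv_Ioo (a := p - 1) (b := p) (c := p + 1) (by linarith) (by linarith)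
      (hd p).continuousAt (fun t _ => (hd t).differentiableAt.differentiableWithinAt)
      (fun t _ => (hd t).differentiableAt.differentiableWithinAt) ?_ ?_
    · intro t ht
      rw [hdd]
      have := (hρ.strictMono_add_mul_deriv hl).monotone ht.2.le
      simp only at this ⊢
      linarith
    · intro t ht
      rw [hdd]
      have := (hρ.strictMono_add_mul_deriv hl).monotone ht.1.le
      simp only at this ⊢
      linarith

lemma prox_add_mul_deriv (hρ : IsActivationLoss ρ) {l : ℝ} (hl : 0 ≤ l) (z : ℝ) :
    prox l ρ z + l * deriv ρ (prox l ρ z) = z := by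
  obtain ⟨p, hp⟩ := hρ.exists_add_mul_deriv_eq hl z
  exact (hρ.isMinOn_prox_objective_iff hl z _).1
    (Classical.epsilon_spec (p := fun x : ℝ =>
      IsMinOn (fun t : ℝ => l * ρ t + (t - z) ^ 2 / 2) Set.univ x)
      ⟨p, (hρ.isMinOn_prox_objective_iff hl z p).2 hp⟩)

lemma prox_eq_of_add_mul_deriv_eq (hρ : IsActivationLoss ρ) {l : ℝ} (hl : 0 ≤ l) {p z : ℝ}
    (h : p + l * deriv ρ p = z) : prox l ρ z = p :=
  (hρ.strictMono_add_mul_deriv hl).injective ((hρ.prox_add_mul_deriv hl z).trans h.symm)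

lemma prox_zero (hρ : IsActivationLoss ρ) (z : ℝ) : prox 0 ρ z = z :=
  hρ.prox_eq_of_add_mul_deriv_eq le_rfl (by simp)

lemma monotone_prox (hρ : IsActivationLoss ρ) {l : ℝ} (hl : 0 ≤ l) : Monotone (prox l ρ) := by
  intro x y hxy
  rw [← (hρ.strictMono_add_mul_deriv hl).le_iff_le]
  simpa only [hρ.prox_add_mul_deriv hl] using hxy

/-- Subtract the two stationarity equations: `p - p'` and `l (ρ'(p) - ρ'(p'))` have the same sign,
and `ρ'` takes values in `[0, 1]`. -/
lemma abs_prox_sub_prox_le (hρ : IsActivationLoss ρ) {l l' : ℝ} (hl : 0 ≤ l) (hl' : 0 ≤ l')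
    (z z' : ℝ) : |prox l ρ z - prox l' ρ z'| ≤ |z - z'| + |l - l'| := by
  have h1 := hρ.prox_add_mul_deriv hl z
  have h2 := hρ.prox_add_mul_deriv hl' z'
  set p := prox l ρ z
  set p' := prox l' ρ z'
  have hu := hρ.mem_unit p'
  have hprod : |(l - l') * deriv ρ p'| ≤ |l - l'| := by
    rw [abs_mul, abs_of_nonneg hu.1]
    exact mul_le_of_le_one_right (abs_nonneg _) hu.2
  have a1 := abs_le.1 hprod
  have a2 := neg_abs_le (z - z')
  have a3 := le_abs_self (z - z')
  rcases le_total p p' with h | h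
  · have := mul_le_mul_of_nonneg_left (hρ.monotone h) hl
    rw [abs_of_nonpos (by linarith)]
    nlinarith
  · have := mul_le_mul_of_nonneg_left (hρ.monotone h) hl
    rw [abs_of_nonneg (by linarith)]
    nlinarith

/-- The absolute value extends the operator to negative parameters, so `l = 0` becomes an interior
point and limits there are ordinary values. -/
lemma continuous_prox_abs (hρ : IsActivationLoss ρ) :
    Continuous fun x : ℝ × ℝ => prox |x.1| ρ x.2 := by
  rw [Metric.continuous_iff']
  intro a ε hε
  have hc : Continuous fun x : ℝ × ℝ => |x.2 - a.2| + |(|x.1| - |a.1|)| := by fun_prop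
  have := hc.continuousAt (x := a)
  have h0 : (|a.2 - a.2| + |(|a.1| - |a.1|)| : ℝ) < ε := by simpa using hε
  filter_upwards [this.eventually (gt_mem_nhds h0)] with x hx
  exact (hρ.abs_prox_sub_prox_le (abs_nonneg _) (abs_nonneg _) _ _).trans_lt hx

lemma continuous_prox (hρ : IsActivationLoss ρ) {l : ℝ} (hl : 0 ≤ l) : Continuous (prox l ρ) := by
  have := hρ.continuous_prox_abs.comp (Continuous.prodMk_right l)
  simpa only [Function.comp_def, abs_of_nonneg hl] using this

lemma one_add_pos (hρ : IsActivationLoss ρ) {l : ℝ} (hl : 0 ≤ l) (x : ℝ) :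
    0 < 1 + l * iteratedDeriv 2 ρ x := by
  have := mul_nonneg hl (hρ.deriv_two_nonneg x)
  linarith

lemma hasDerivAt_prox (hρ : IsActivationLoss ρ) {l : ℝ} (hl : 0 ≤ l) (z : ℝ) :
    HasDerivAt (prox l ρ) (1 + l * iteratedDeriv 2 ρ (prox l ρ z))⁻¹ z := by
  refine HasDerivAt.of_local_left_inverse (f := fun t => t + l * deriv ρ t)
    (hρ.continuous_prox hl).continuousAt ?_ (hρ.one_add_pos hl _).ne'
    (Eventually.of_forall fun y => hρ.prox_add_mul_deriv hl y)
  exact (hasDerivAt_id _).add ((hρ.hasDerivAt_deriv _).const_mul l)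

end IsActivationLoss

/-! ### Gaussian representation and integration tools -/

/-- The law of a pair of independent centered normal variables of variances `γ²` and `1`. -/
noncomputable def gaussPair (γ : ℝ) : Measure (ℝ × ℝ) :=
  (gaussianReal 0 (Real.toNNReal (γ ^ 2))).prod (gaussianReal 0 1)

instance (γ : ℝ) : IsProbabilityMeasure (gaussPair γ) := by
  unfold gaussPair
  infer_instance

lemma isOpenPosMeasure_gaussianReal (m : ℝ) {v : NNReal} (hv : v ≠ 0) :
    (gaussianReal m v).IsOpenPosMeasure :=
  (gaussianReal_absolutelyContinuous' m hv).isOpenPosMeasure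

lemma toNNReal_sq_ne_zero {γ : ℝ} (hγ : 0 < γ) : Real.toNNReal (γ ^ 2) ≠ 0 :=
  (Real.toNNReal_pos.2 (pow_pos hγ 2)).ne'

lemma isOpenPosMeasure_gaussPair {γ : ℝ} (hγ : 0 < γ) : (gaussPair γ).IsOpenPosMeasure := by
  have := isOpenPosMeasure_gaussianReal 0 (toNNReal_sq_ne_zero hγ)
  have := isOpenPosMeasure_gaussianReal 0 (one_ne_zero (α := NNReal))
  unfold gaussPair
  infer_instance

/-- The lower triangular factor is the one that expresses `Q₂` as `-α Q₁ + √κ σ Z`. -/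
lemma posSemidef_covQ {κ : ℝ} (hκ : 0 ≤ κ) (γ α σ : ℝ) : (covQ γ κ α σ).PosSemidef := by
  have h : covQ γ κ α σ = !![γ, 0; -α * γ, √κ * σ] * (!![γ, 0; -α * γ, √κ * σ]).conjTranspose := by
    have := Real.mul_self_sqrt hκ
    ext i j
    fin_cases i <;> fin_cases j <;> simp [covQ, Matrix.mul_apply, Fin.sum_univ_two] <;>
      nlinarith
  rw [h]
  exact Matrix.posSemidef_self_mul_conjTranspose _

/-- Characteristic functions agree: that of the image factors by independence. -/
lemma lawQ_eq_map {κ : ℝ} (hκ : 0 ≤ κ) (γ α σ : ℝ) :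
    lawQ γ κ α σ = (gaussPair γ).map
      (fun x => (!₂[x.1, -α * x.1 + √κ * σ * x.2] : EuclideanSpace ℝ (Fin 2))) := by
  have hc : Continuous fun x : ℝ × ℝ =>
      (!₂[x.1, -α * x.1 + √κ * σ * x.2] : EuclideanSpace ℝ (Fin 2)) := by fun_prop
  have := Measure.isProbabilityMeasure_map (μ := gaussPair γ) hc.measurable.aemeasurable
  have : IsProbabilityMeasure (lawQ γ κ α σ) := by unfold lawQ; infer_instance
  apply Measure.ext_of_charFun
  ext t
  rw [lawQ, charFun_multivariateGaussian (posSemidef_covQ hκ γ α σ), charFun_apply,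
    integral_map hc.measurable.aemeasurable (by fun_prop)]
  have hintegral : ∀ x : ℝ × ℝ, Complex.exp
      ((inner ℝ (!₂[x.1, -α * x.1 + √κ * σ * x.2] : EuclideanSpace ℝ (Fin 2)) t : ℝ) * Complex.I) =
      Complex.exp ((t 0 - α * t 1 : ℝ) * x.1 * Complex.I) *
        Complex.exp ((√κ * σ * t 1 : ℝ) * x.2 * Complex.I) := by
    intro x
    rw [← Complex.exp_add]
    congr 1
    simp [PiLp.inner_apply, Fin.sum_univ_two]
    ring
  simp_rw [hintegral]
  rw [gaussPair, integral_prod_mul (fun x : ℝ => Complex.exp ((t 0 - α * t 1 : ℝ) * x * Complex.I))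
    (fun z : ℝ => Complex.exp ((√κ * σ * t 1 : ℝ) * z * Complex.I)),
    ← charFun_apply_real, ← charFun_apply_real, charFun_gaussianReal, charFun_gaussianReal,
    ← Complex.exp_add]
  have hk : ((√κ : ℝ) : ℂ) ^ 2 = (κ : ℂ) := by
    rw [← Complex.ofReal_pow, Real.sq_sqrt hκ]
  congr 1
  simp [covQ, Matrix.mulVec, dotProduct, Fin.sum_univ_two, Real.coe_toNNReal _ (sq_nonneg γ)]
  linear_combination (-(σ : ℂ) ^ 2 * (t 1 : ℂ) ^ 2 / 2) * (- hk)

lemma integral_lawQ {κ : ℝ} (hκ : 0 ≤ κ) (γ α σ : ℝ) {F : ℝ → ℝ → ℝ}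
    (hF : Continuous fun x : ℝ × ℝ => F x.1 x.2) :
    ∫ Q, F (Q 0) (Q 1) ∂lawQ γ κ α σ =
      ∫ x, F x.1 (-α * x.1 + √κ * σ * x.2) ∂gaussPair γ := by
  have hc : Continuous fun x : ℝ × ℝ =>
      (!₂[x.1, -α * x.1 + √κ * σ * x.2] : EuclideanSpace ℝ (Fin 2)) := by fun_prop
  have hF' : Continuous fun Q : EuclideanSpace ℝ (Fin 2) => F (Q 0) (Q 1) :=
    hF.comp (by fun_prop : Continuous fun Q : EuclideanSpace ℝ (Fin 2) => (Q 0, Q 1))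
  rw [lawQ_eq_map hκ, integral_map hc.measurable.aemeasurable hF'.aestronglyMeasurable]
  simp

lemma integrable_sq_gaussianReal (m : ℝ) (v : NNReal) :
    Integrable (fun x : ℝ => x ^ 2) (gaussianReal m v) :=
  (memLp_id_gaussianReal (μ := m) (v := v) 2).integrable_sq

/-- The common dominating function for the unbounded integrands. -/
lemma integrable_gaussPair_bound (γ : ℝ) :
    Integrable (fun x : ℝ × ℝ => (1 + x.1 ^ 2) * (1 + x.2 ^ 2)) (gaussPair γ) := by
  unfold gaussPair
  exact Integrable.mul_prod (f := fun q : ℝ => 1 + q ^ 2) (g := fun z : ℝ => 1 + z ^ 2)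
    ((integrable_const 1).add (integrable_sq_gaussianReal _ _))
    ((integrable_const 1).add (integrable_sq_gaussianReal _ _))

lemma integrable_gaussPair_of_le {γ : ℝ} {F : ℝ × ℝ → ℝ} (hF : Continuous F) (C : ℝ)
    (h : ∀ x, |F x| ≤ C * ((1 + x.1 ^ 2) * (1 + x.2 ^ 2))) : Integrable F (gaussPair γ) :=
  ((integrable_gaussPair_bound γ).const_mul C).mono' hF.aestronglyMeasurable
    (Eventually.of_forall h)

lemma abs_le_one_add_sq (x : ℝ) : |x| ≤ 1 + x ^ 2 := by
  rw [← sq_abs]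
  nlinarith [sq_nonneg (|x| - 1), abs_nonneg x]

lemma integral_gaussPair_fst (γ : ℝ) (F : ℝ → ℝ) :
    ∫ x, F x.1 ∂gaussPair γ = gaussE γ F := by
  have := integral_prod_mul (μ := gaussianReal 0 (Real.toNNReal (γ ^ 2)))
    (ν := gaussianReal 0 1) F (fun _ => (1 : ℝ))
  simpa [gaussPair, gaussE] using this

lemma integral_gaussPair_mul (γ : ℝ) (F G : ℝ → ℝ) :
    ∫ x, F x.1 * G x.2 ∂gaussPair γ = gaussE γ F * ∫ z, G z ∂gaussianReal 0 1 :=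
  integral_prod_mul F G

lemma gaussE_comp_neg (γ : ℝ) (F : ℝ → ℝ) : gaussE γ (fun q => F (-q)) = gaussE γ F := by
  unfold gaussE
  have h := gaussianReal_map_neg (μ := 0) (v := Real.toNNReal (γ ^ 2))
  rw [neg_zero] at h
  conv_rhs => rw [← h]
  exact ((Homeomorph.neg ℝ).measurableEmbedding.integral_map F).symm

lemma gaussE_eq_zero_of_odd (γ : ℝ) {F : ℝ → ℝ} (hF : ∀ q, F (-q) = -F q) : gaussE γ F = 0 := by
  have h := gaussE_comp_neg γ F
  simp only [hF, gaussE, integral_neg] at h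
  unfold gaussE
  linarith

lemma integral_sq_gaussianReal_one : ∫ z : ℝ, z ^ 2 ∂gaussianReal 0 1 = 1 := by
  have h := variance_fun_id_gaussianReal (μ := 0) (v := 1)
  rw [variance_eq_integral (by fun_prop)] at h
  simpa using h

/-- A continuous nonnegative integrable function with vanishing integral against a measure of full
support vanishes identically. -/
lemma eq_zero_of_integral_eq_zero {X : Type*} [TopologicalSpace X] [MeasurableSpace X]
    {μ : Measure X} [μ.IsOpenPosMeasure] {F : X → ℝ} (hF : Continuous F) (hi : Integrable F μ)
    (h0 : ∀ x, 0 ≤ F x) (h : ∫ x, F x ∂μ = 0) (x : X) : F x = 0 := by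
  have h1 := (integral_eq_zero_iff_of_nonneg h0 hi).1 h
  exact congrFun ((hF.ae_eq_iff_eq μ continuous_const).1 h1) x

/-! ### Gaussian integration by parts -/

lemma hasDerivAt_exp_neg_sq_half (x : ℝ) :
    HasDerivAt (fun x : ℝ => Real.exp (-(1 / 2) * x ^ 2)) (-(x * Real.exp (-(1 / 2) * x ^ 2))) x := by
  refine (((hasDerivAt_pow 2 x).const_mul (-(1 / 2) : ℝ)).exp).congr_deriv ?_
  push_cast
  ring

lemma integral_gaussianReal_one_eq (F : ℝ → ℝ) :
    ∫ z, F z ∂gaussianReal 0 1 = (√(2 * Real.pi))⁻¹ * ∫ z, F z * Real.exp (-(1 / 2) * z ^ 2) := by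
  rw [integral_gaussianReal_eq_integral_smul one_ne_zero, ← integral_const_mul]
  refine integral_congr_ae (Eventually.of_forall fun z => ?_)
  simp only [gaussianPDFReal, NNReal.coe_one, mul_one, sub_zero, smul_eq_mul]
  have : -z ^ 2 / 2 = -(1 / 2) * z ^ 2 := by ring
  rw [this]
  ring

/-- Stein's identity: the Gaussian density has derivative `-z` times itself. -/
lemma integral_mul_gaussianReal_eq_integral_deriv {g g' : ℝ → ℝ} {M M' : ℝ}
    (hg : ∀ x, HasDerivAt g (g' x) x) (hg' : Continuous g') (hM : ∀ x, |g x| ≤ M)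
    (hM' : ∀ x, |g' x| ≤ M') :
    ∫ z, z * g z ∂gaussianReal 0 1 = ∫ z, g' z ∂gaussianReal 0 1 := by
  have hgc : Continuous g := continuous_iff_continuousAt.2 fun x => (hg x).continuousAt
  have i1 : Integrable fun x : ℝ => Real.exp (-(1 / 2) * x ^ 2) :=
    integrable_exp_neg_mul_sq (by norm_num)
  have i2 : Integrable fun x : ℝ => -(x * Real.exp (-(1 / 2) * x ^ 2)) :=
    (integrable_mul_exp_neg_mul_sq (by norm_num)).neg
  have h := integral_mul_deriv_eq_deriv_mul_of_integrable (u := g) (u' := g')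
    (v := fun x : ℝ => Real.exp (-(1 / 2) * x ^ 2))
    (v' := fun x : ℝ => -(x * Real.exp (-(1 / 2) * x ^ 2)))
    (fun x _ => hg x) (fun x _ => hasDerivAt_exp_neg_sq_half x)
    (i2.bdd_mul hgc.aestronglyMeasurable (Eventually.of_forall hM))
    (i1.bdd_mul hg'.aestronglyMeasurable (Eventually.of_forall hM'))
    (i1.bdd_mul hgc.aestronglyMeasurable (Eventually.of_forall hM))
  rw [integral_gaussianReal_one_eq, integral_gaussianReal_one_eq]
  congr 1
  rw [← neg_inj, ← h, ← integral_neg]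
  refine integral_congr_ae (Eventually.of_forall fun z => ?_)
  simp only
  ring

/-- Stein's identity in the second coordinate with the first one frozen; the factor `s` comes from
the chain rule. -/
lemma integral_gaussPair_mul_snd {γ α s : ℝ} {w g g' : ℝ → ℝ} {W M M' : ℝ} (hw : Continuous w)
    (hW : ∀ x, |w x| ≤ W) (hg : ∀ x, HasDerivAt g (g' x) x) (hg' : Continuous g')
    (hM : ∀ x, |g x| ≤ M) (hM' : ∀ x, |g' x| ≤ M') :
    ∫ x, w x.1 * (x.2 * g (-α * x.1 + s * x.2)) ∂gaussPair γ =
      s * ∫ x, w x.1 * g' (-α * x.1 + s * x.2) ∂gaussPair γ := by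
  have hgc : Continuous g := continuous_iff_continuousAt.2 fun x => (hg x).continuousAt
  have hW0 : 0 ≤ W := (abs_nonneg _).trans (hW 0)
  have hM0 : 0 ≤ M := (abs_nonneg _).trans (hM 0)
  have hM0' : 0 ≤ M' := (abs_nonneg _).trans (hM' 0)
  have i1 : Integrable (fun x : ℝ × ℝ => w x.1 * (x.2 * g (-α * x.1 + s * x.2)))
      (gaussPair γ) := by
    refine integrable_gaussPair_of_le (by fun_prop) (W * M) fun x => ?_
    rw [abs_mul, abs_mul]
    calc |w x.1| * (|x.2| * |g (-α * x.1 + s * x.2)|)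
        ≤ W * ((1 + x.2 ^ 2) * M) := by
          gcongr
          · exact hW _
          · exact abs_le_one_add_sq _
          · exact hM _
      _ ≤ W * M * ((1 + x.1 ^ 2) * (1 + x.2 ^ 2)) := by
          nlinarith [mul_nonneg (mul_nonneg hW0 hM0) (mul_nonneg (sq_nonneg x.1)
            (by positivity : 0 ≤ 1 + x.2 ^ 2))]
  have i2 : Integrable (fun x : ℝ × ℝ => w x.1 * (s * g' (-α * x.1 + s * x.2)))
      (gaussPair γ) := by
    refine integrable_gaussPair_of_le (by fun_prop) (W * (|s| * M')) fun x => ?_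
    rw [abs_mul, abs_mul]
    calc |w x.1| * (|s| * |g' (-α * x.1 + s * x.2)|)
        ≤ W * (|s| * M') * (1 * 1) := by
          rw [mul_one, mul_one]
          gcongr
          · exact hW _
          · exact hM' _
      _ ≤ W * (|s| * M') * ((1 + x.1 ^ 2) * (1 + x.2 ^ 2)) := by
          gcongr
          · linarith [sq_nonneg x.1]
          · linarith [sq_nonneg x.2]
  have h2 : s * ∫ x, w x.1 * g' (-α * x.1 + s * x.2) ∂gaussPair γ =
      ∫ x, w x.1 * (s * g' (-α * x.1 + s * x.2)) ∂gaussPair γ := by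
    rw [← integral_const_mul]
    congr 1
    ext x
    ring
  rw [h2]
  unfold gaussPair at i1 i2 ⊢
  rw [integral_prod _ i1, integral_prod _ i2]
  congr 1
  ext q
  simp only
  rw [integral_const_mul, integral_const_mul]
  congr 1
  refine integral_mul_gaussianReal_eq_integral_deriv (M := M) (M' := |s| * M') (fun z => ?_)
    (by fun_prop) (fun z => hM _) (fun z => ?_)
  · have h1 : HasDerivAt (fun z => -α * q + s * z) s z := by
      simpa using ((hasDerivAt_id z).const_mul s).const_add (-α * q)
    exact ((hg _).comp z h1).congr_deriv (mul_comm _ _)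
  · rw [abs_mul]
    exact mul_le_mul_of_nonneg_left (hM' _) (abs_nonneg _)

/-! ### Moreau envelope, the three functionals and the reduced system -/

/-- The derivative of the Moreau envelope of `ρ` with parameter `|l|`. -/
noncomputable def envGrad (ρ : ℝ → ℝ) (l x : ℝ) : ℝ := deriv ρ (prox |l| ρ x)

/-- The second derivative of the Moreau envelope of `ρ` with parameter `|l|`. -/
noncomputable def envHess (ρ : ℝ → ℝ) (l x : ℝ) : ℝ :=
  iteratedDeriv 2 ρ (prox |l| ρ x) / (1 + |l| * iteratedDeriv 2 ρ (prox |l| ρ x))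

/-- The correlation of `Q₁` with the envelope gradient at `Q₂ = -α Q₁ + s Z`. -/
noncomputable def corrInt (ρ : ℝ → ℝ) (γ α s l : ℝ) : ℝ :=
  ∫ x, deriv ρ x.1 * (x.1 * envGrad ρ l (-α * x.1 + s * x.2)) ∂gaussPair γ

/-- The weighted second moment of the envelope gradient at `Q₂ = -α Q₁ + s Z`. -/
noncomputable def energyInt (ρ : ℝ → ℝ) (γ α s l : ℝ) : ℝ :=
  ∫ x, 2 * deriv ρ x.1 * envGrad ρ l (-α * x.1 + s * x.2) ^ 2 ∂gaussPair γ

/-- The weighted mean of the envelope Hessian at `Q₂ = -α Q₁ + s Z`. -/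
noncomputable def slopeInt (ρ : ℝ → ℝ) (γ α s l : ℝ) : ℝ :=
  ∫ x, 2 * deriv ρ x.1 * envHess ρ l (-α * x.1 + s * x.2) ∂gaussPair γ

/-- The system of fixed-point equations in the variable `s = √κ σ`. -/
structure ReducedSystem (ρ : ℝ → ℝ) (γ κ α s l : ℝ) : Prop where
  corr : corrInt ρ γ α s l = 0
  energy : κ * s ^ 2 = l ^ 2 * energyInt ρ γ α s l
  slope : κ = l * slopeInt ρ γ α s l

namespace IsActivationLoss

variable {ρ : ℝ → ℝ}

lemma continuous_envGrad_uncurry (hρ : IsActivationLoss ρ) :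
    Continuous fun x : ℝ × ℝ => envGrad ρ x.1 x.2 :=
  hρ.continuous_deriv.comp hρ.continuous_prox_abs

lemma continuous_envHess_comp (hρ : IsActivationLoss ρ) {X : Type*} [TopologicalSpace X]
    {a b : X → ℝ} (ha : Continuous a) (hb : Continuous b) :
    Continuous fun x => envHess ρ (a x) (b x) := by
  have h : Continuous fun x => iteratedDeriv 2 ρ (prox |a x| ρ (b x)) :=
    hρ.continuous_deriv_two.comp (hρ.continuous_prox_abs.comp (ha.prodMk hb))
  unfold envHess
  exact h.div (continuous_const.add ((continuous_abs.comp ha).mul h))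
    fun x => (hρ.one_add_pos (abs_nonneg _) _).ne'

lemma continuous_envGrad (hρ : IsActivationLoss ρ) (l : ℝ) : Continuous (envGrad ρ l) :=
  hρ.continuous_envGrad_uncurry.comp (Continuous.prodMk_right l)

lemma continuous_envHess (hρ : IsActivationLoss ρ) (l : ℝ) : Continuous (envHess ρ l) :=
  hρ.continuous_envHess_comp continuous_const continuous_id

lemma envGrad_zero (hρ : IsActivationLoss ρ) (x : ℝ) : envGrad ρ 0 x = deriv ρ x := by
  rw [envGrad, abs_zero, hρ.prox_zero]

lemma envHess_zero (hρ : IsActivationLoss ρ) (x : ℝ) :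
    envHess ρ 0 x = iteratedDeriv 2 ρ x := by
  simp [envHess, hρ.prox_zero]

lemma hasDerivAt_envGrad (hρ : IsActivationLoss ρ) (l x : ℝ) :
    HasDerivAt (envGrad ρ l) (envHess ρ l x) x :=
  (hρ.hasDerivAt_deriv _).comp x (hρ.hasDerivAt_prox (abs_nonneg l) x)

lemma monotone_envGrad (hρ : IsActivationLoss ρ) (l : ℝ) : Monotone (envGrad ρ l) :=
  hρ.monotone.comp (hρ.monotone_prox (abs_nonneg l))

lemma envGrad_nonneg (hρ : IsActivationLoss ρ) (l x : ℝ) : 0 ≤ envGrad ρ l x :=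
  (hρ.mem_unit _).1

lemma envGrad_le_one (hρ : IsActivationLoss ρ) (l x : ℝ) : envGrad ρ l x ≤ 1 :=
  (hρ.mem_unit _).2

lemma abs_envGrad_le_one (hρ : IsActivationLoss ρ) (l x : ℝ) : |envGrad ρ l x| ≤ 1 := by
  rw [abs_of_nonneg (hρ.envGrad_nonneg l x)]
  exact hρ.envGrad_le_one l x

lemma abs_deriv_le_one (hρ : IsActivationLoss ρ) (x : ℝ) : |deriv ρ x| ≤ 1 := by
  rw [abs_of_nonneg (hρ.mem_unit x).1]
  exact (hρ.mem_unit x).2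

lemma abs_envHess_le (hρ : IsActivationLoss ρ) {M : ℝ} (hM : ∀ x, |iteratedDeriv 2 ρ x| ≤ M)
    (l x : ℝ) : |envHess ρ l x| ≤ M := by
  have h0 := hρ.deriv_two_nonneg (prox |l| ρ x)
  have h1 : 1 ≤ 1 + |l| * iteratedDeriv 2 ρ (prox |l| ρ x) := by
    linarith [mul_nonneg (abs_nonneg l) h0]
  rw [envHess, abs_of_nonneg (div_nonneg h0 (by linarith))]
  exact (div_le_self h0 h1).trans ((le_abs_self _).trans (hM _))

lemma prox_abs_eq_sub (hρ : IsActivationLoss ρ) (l x : ℝ) :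
    prox |l| ρ x = x - |l| * envGrad ρ l x := by
  rw [envGrad]
  linarith [hρ.prox_add_mul_deriv (abs_nonneg l) x]

lemma envGrad_add_mul_deriv (hρ : IsActivationLoss ρ) (l p : ℝ) :
    envGrad ρ l (p + |l| * deriv ρ p) = deriv ρ p := by
  rw [envGrad, hρ.prox_eq_of_add_mul_deriv_eq (abs_nonneg l) rfl]

lemma not_envGrad_const (hρ : IsActivationLoss ρ) (l : ℝ) :
    ¬ ∀ x y, envGrad ρ l x = envGrad ρ l y := by
  intro h
  obtain ⟨y, z, hyz⟩ := hρ.nonconstant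
  exact hyz (by rw [← hρ.envGrad_add_mul_deriv l y, ← hρ.envGrad_add_mul_deriv l z]; exact h _ _)

lemma gaussE_deriv (hρ : IsActivationLoss ρ) (γ : ℝ) : gaussE γ (deriv ρ) = 1 / 2 := by
  have hi : Integrable (deriv ρ) (gaussianReal 0 (Real.toNNReal (γ ^ 2))) :=
    Integrable.of_bound hρ.continuous_deriv.aestronglyMeasurable 1
      (Eventually.of_forall hρ.abs_deriv_le_one)
  have h := gaussE_comp_neg γ (deriv ρ)
  simp only [hρ.deriv_neg] at h
  unfold gaussE at h ⊢
  rw [integral_sub (integrable_const 1) hi] at h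
  simp at h
  linarith

lemma integrable_bounded_gaussPair {γ : ℝ} {F : ℝ × ℝ → ℝ} (hF : Continuous F) (C : ℝ)
    (h : ∀ x, |F x| ≤ C) : Integrable F (gaussPair γ) :=
  Integrable.of_bound hF.aestronglyMeasurable C (Eventually.of_forall h)

/-- With `d = ρ''(prox)`, use `1/(1 + l d) = 1 - l d/(1 + l d)` and `E[2ρ'(Q₁)] = 1`; the third
equation thus reads `κ = l C`. -/
lemma integral_div_one_add (hρ : IsActivationLoss ρ) (γ α s l : ℝ) :
    ∫ x, 2 * deriv ρ x.1 / (1 + |l| * iteratedDeriv 2 ρ (prox |l| ρ (-α * x.1 + s * x.2)))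
      ∂gaussPair γ = 1 - |l| * slopeInt ρ γ α s l := by
  obtain ⟨M, hM0, hM⟩ := hρ.exists_bound_two
  have c1 := hρ.continuous_deriv
  have c2 := hρ.continuous_envHess l
  have i1 : Integrable (fun x : ℝ × ℝ => 2 * deriv ρ x.1) (gaussPair γ) := by
    refine integrable_bounded_gaussPair (by fun_prop) 2 fun x => ?_
    rw [abs_mul, abs_two]
    linarith [hρ.abs_deriv_le_one x.1]
  have i2 : Integrable (fun x : ℝ × ℝ => 2 * deriv ρ x.1 * envHess ρ l (-α * x.1 + s * x.2))
      (gaussPair γ) :=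
    i1.mul_bdd (c2.comp (by fun_prop)).aestronglyMeasurable
      (Eventually.of_forall fun x => hρ.abs_envHess_le hM l _)
  have h1 : ∫ x : ℝ × ℝ, 2 * deriv ρ x.1 ∂gaussPair γ = 1 := by
    rw [integral_const_mul, integral_gaussPair_fst, hρ.gaussE_deriv]
    norm_num
  rw [slopeInt, ← integral_const_mul]
  conv_rhs => rw [← h1]
  rw [← integral_sub i1 (i2.const_mul _)]
  congr 1
  ext x
  have hp := hρ.one_add_pos (abs_nonneg l) (prox |l| ρ (-α * x.1 + s * x.2))
  rw [envHess]
  generalize iteratedDeriv 2 ρ (prox |l| ρ (-α * x.1 + s * x.2)) = d at hp ⊢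
  field_simp
  ring

/-- In the variable `s = √κ σ` the law of the pair no longer involves `κ`, which survives only as an
explicit factor. -/
lemma solvesSystem_iff (hρ : IsActivationLoss ρ) (γ α σ : ℝ) {κ l : ℝ} (hκ : 0 < κ) (hl : 0 < l) :
    SolvesSystem ρ γ κ α σ l ↔ ReducedSystem ρ γ κ α (√κ * σ) l := by
  have habs : |l| = l := abs_of_pos hl
  have c1 := hρ.continuous_deriv
  have c2 := hρ.continuous_deriv_two
  have c3 : Continuous (prox l ρ) := hρ.continuous_prox hl.le
  have e1 : ∫ Q, 2 * deriv ρ (Q 0) * (l ^ 2 * deriv ρ (prox l ρ (Q 1)) ^ 2) ∂lawQ γ κ α σ =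
      l ^ 2 * energyInt ρ γ α (√κ * σ) l := by
    rw [integral_lawQ hκ.le γ α σ
      (F := fun a b => 2 * deriv ρ a * (l ^ 2 * deriv ρ (prox l ρ b) ^ 2)) (by fun_prop),
      energyInt, ← integral_const_mul]
    congr 1
    ext x
    rw [envGrad, habs]
    ring
  have e2 : ∫ Q, deriv ρ (Q 0) * Q 0 * (l * deriv ρ (prox l ρ (Q 1))) ∂lawQ γ κ α σ =
      l * corrInt ρ γ α (√κ * σ) l := by
    rw [integral_lawQ hκ.le γ α σ
      (F := fun a b => deriv ρ a * a * (l * deriv ρ (prox l ρ b))) (by fun_prop),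
      corrInt, ← integral_const_mul]
    congr 1
    ext x
    rw [envGrad, habs]
    ring
  have e3 : ∫ Q, 2 * deriv ρ (Q 0) / (1 + l * iteratedDeriv 2 ρ (prox l ρ (Q 1)))
      ∂lawQ γ κ α σ = 1 - l * slopeInt ρ γ α (√κ * σ) l := by
    rw [integral_lawQ hκ.le γ α σ
      (F := fun a b => 2 * deriv ρ a / (1 + l * iteratedDeriv 2 ρ (prox l ρ b)))]
    · have := hρ.integral_div_one_add γ α (√κ * σ) l
      rwa [habs] at this
    · exact Continuous.div (by fun_prop) (by fun_prop) fun x => (hρ.one_add_pos hl.le _).ne'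
  have hs : (√κ * σ) ^ 2 = κ * σ ^ 2 := by rw [mul_pow, Real.sq_sqrt hκ.le]
  have hE : σ ^ 2 = 1 / κ ^ 2 * (l ^ 2 * energyInt ρ γ α (√κ * σ) l) ↔
      κ * (√κ * σ) ^ 2 = l ^ 2 * energyInt ρ γ α (√κ * σ) l := by
    rw [hs, one_div, eq_inv_mul_iff_mul_eq₀ (by positivity), ← mul_assoc, sq κ]
  rw [SolvesSystem, e1, e2, e3, hE]
  constructor
  · rintro ⟨h1, h2, h3⟩
    exact ⟨(mul_eq_zero.1 h2.symm).resolve_left hl.ne', h1, by linarith⟩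
  · rintro ⟨h1, h2, h3⟩
    exact ⟨h2, by rw [h1, mul_zero], by linarith⟩

/-! ### Continuity of the three functionals -/

lemma continuous_corrInt (hρ : IsActivationLoss ρ) (γ : ℝ) :
    Continuous fun u : ℝ × ℝ × ℝ => corrInt ρ γ u.1 u.2.1 u.2.2 := by
  have c1 := hρ.continuous_deriv
  have c2 := hρ.continuous_envGrad_uncurry
  unfold corrInt
  refine continuous_of_dominated (bound := fun x => (1 + x.1 ^ 2) * (1 + x.2 ^ 2)) (fun u => ?_)
    (fun u => Eventually.of_forall fun x => ?_) (integrable_gaussPair_bound γ)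
    (Eventually.of_forall fun x => ?_)
  · have := hρ.continuous_envGrad u.2.2
    exact (by fun_prop : Continuous _).aestronglyMeasurable
  · rw [norm_mul, norm_mul]
    calc ‖deriv ρ x.1‖ * (‖x.1‖ * ‖envGrad ρ u.2.2 (-u.1 * x.1 + u.2.1 * x.2)‖)
        ≤ 1 * ((1 + x.1 ^ 2) * 1) := by
          gcongr
          · exact hρ.abs_deriv_le_one _
          · exact abs_le_one_add_sq _
          · exact hρ.abs_envGrad_le_one _ _
      _ ≤ (1 + x.1 ^ 2) * (1 + x.2 ^ 2) := by
          rw [one_mul]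
          gcongr
          linarith [sq_nonneg x.2]
  · exact continuous_const.mul (continuous_const.mul (c2.comp
      (by fun_prop : Continuous fun u : ℝ × ℝ × ℝ => (u.2.2, -u.1 * x.1 + u.2.1 * x.2))))

lemma continuous_energyInt (hρ : IsActivationLoss ρ) (γ : ℝ) :
    Continuous fun u : ℝ × ℝ × ℝ => energyInt ρ γ u.1 u.2.1 u.2.2 := by
  have c1 := hρ.continuous_deriv
  have c2 := hρ.continuous_envGrad_uncurry
  unfold energyInt
  refine continuous_of_dominated (bound := fun _ => 2) (fun u => ?_)
    (fun u => Eventually.of_forall fun x => ?_) (integrable_const _)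
    (Eventually.of_forall fun x => ?_)
  · have := hρ.continuous_envGrad u.2.2
    exact (by fun_prop : Continuous _).aestronglyMeasurable
  · rw [norm_mul, norm_mul, norm_pow, Real.norm_two]
    calc 2 * ‖deriv ρ x.1‖ * ‖envGrad ρ u.2.2 (-u.1 * x.1 + u.2.1 * x.2)‖ ^ 2
        ≤ 2 * 1 * 1 ^ 2 := by
          gcongr
          · exact hρ.abs_deriv_le_one _
          · exact hρ.abs_envGrad_le_one _ _
      _ = 2 := by norm_num
  · exact continuous_const.mul ((c2.comp
      (by fun_prop : Continuous fun u : ℝ × ℝ × ℝ => (u.2.2, -u.1 * x.1 + u.2.1 * x.2))).pow 2)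

lemma continuous_slopeInt (hρ : IsActivationLoss ρ) (γ : ℝ) :
    Continuous fun u : ℝ × ℝ × ℝ => slopeInt ρ γ u.1 u.2.1 u.2.2 := by
  obtain ⟨M, hM0, hM⟩ := hρ.exists_bound_two
  have c1 := hρ.continuous_deriv
  unfold slopeInt
  refine continuous_of_dominated (bound := fun _ => 2 * 1 * M) (fun u => ?_)
    (fun u => Eventually.of_forall fun x => ?_) (integrable_const _)
    (Eventually.of_forall fun x => ?_)
  · have := hρ.continuous_envHess u.2.2
    exact (by fun_prop : Continuous _).aestronglyMeasurable
  · rw [norm_mul, norm_mul, Real.norm_two]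
    gcongr
    · exact hρ.abs_deriv_le_one _
    · exact hρ.abs_envHess_le hM _ _
  · exact continuous_const.mul (hρ.continuous_envHess_comp (by fun_prop) (by fun_prop))

/-! ### Values and positivity at the degenerate point -/

/-- Here `Q₂ = -Q₁`. With `u = ρ'(q)` and `v = ρ'(-q) = 1 - u`, symmetrizing gives `2uv² + 2vu² =
2uv`. -/
lemma energyInt_one_zero_zero (hρ : IsActivationLoss ρ) (γ : ℝ) :
    energyInt ρ γ 1 0 0 = gaussE γ (fun q => deriv ρ q * deriv ρ (-q)) := by
  have h1 : energyInt ρ γ 1 0 0 = gaussE γ (fun q => 2 * deriv ρ q * deriv ρ (-q) ^ 2) := by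
    rw [energyInt, ← integral_gaussPair_fst]
    simp [hρ.envGrad_zero]
  have h2 := gaussE_comp_neg γ (fun q => 2 * deriv ρ q * deriv ρ (-q) ^ 2)
  simp only [neg_neg] at h2
  have c1 := hρ.continuous_deriv
  have i : ∀ F : ℝ → ℝ, Continuous F → (∀ q, |F q| ≤ 2) →
      Integrable F (gaussianReal 0 (Real.toNNReal (γ ^ 2))) := fun F hF hb =>
    Integrable.of_bound hF.aestronglyMeasurable 2 (Eventually.of_forall hb)
  have hb : ∀ a b : ℝ, |2 * deriv ρ a * deriv ρ b ^ 2| ≤ 2 := by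
    intro a b
    rw [abs_mul, abs_mul, abs_pow, abs_two]
    calc 2 * |deriv ρ a| * |deriv ρ b| ^ 2 ≤ 2 * 1 * 1 ^ 2 := by
          gcongr
          · exact hρ.abs_deriv_le_one _
          · exact hρ.abs_deriv_le_one _
      _ = 2 := by norm_num
  have h3 : gaussE γ (fun q => 2 * deriv ρ q * deriv ρ (-q) ^ 2) +
      gaussE γ (fun q => 2 * deriv ρ (-q) * deriv ρ q ^ 2) =
      2 * gaussE γ (fun q => deriv ρ q * deriv ρ (-q)) := by
    unfold gaussE
    rw [← integral_add (i _ (by fun_prop) fun q => hb _ _) (i _ (by fun_prop) fun q => hb _ _),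
      ← integral_const_mul]
    congr 1
    ext q
    rw [hρ.deriv_neg]
    ring
  rw [h1]
  linarith

lemma slopeInt_one_zero_zero (hρ : IsActivationLoss ρ) (γ : ℝ) :
    slopeInt ρ γ 1 0 0 = gaussE γ (fun q => iteratedDeriv 2 ρ q) := by
  obtain ⟨M, hM0, hM⟩ := hρ.exists_bound_two
  have c1 := hρ.continuous_deriv
  have c2 := hρ.continuous_deriv_two
  have h1 : slopeInt ρ γ 1 0 0 = gaussE γ (fun q => 2 * deriv ρ q * iteratedDeriv 2 ρ q) := by
    rw [slopeInt, ← integral_gaussPair_fst]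
    simp [hρ.envHess_zero, hρ.deriv_two_neg]
  have h2 := gaussE_comp_neg γ (fun q => 2 * deriv ρ q * iteratedDeriv 2 ρ q)
  simp only [hρ.deriv_two_neg] at h2
  have hb : ∀ a b : ℝ, |2 * deriv ρ a * iteratedDeriv 2 ρ b| ≤ 2 * 1 * M := by
    intro a b
    rw [abs_mul, abs_mul, abs_two]
    gcongr
    · exact hρ.abs_deriv_le_one _
    · exact hM _
  have i : ∀ F : ℝ → ℝ, Continuous F → (∀ q, |F q| ≤ 2 * 1 * M) →
      Integrable F (gaussianReal 0 (Real.toNNReal (γ ^ 2))) := fun F hF hb =>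
    Integrable.of_bound hF.aestronglyMeasurable _ (Eventually.of_forall hb)
  have h3 : gaussE γ (fun q => 2 * deriv ρ q * iteratedDeriv 2 ρ q) +
      gaussE γ (fun q => 2 * deriv ρ (-q) * iteratedDeriv 2 ρ q) =
      2 * gaussE γ (fun q => iteratedDeriv 2 ρ q) := by
    unfold gaussE
    rw [← integral_add (i _ (by fun_prop) fun q => hb _ _) (i _ (by fun_prop) fun q => hb _ _),
      ← integral_const_mul]
    congr 1
    ext q
    rw [hρ.deriv_neg]
    ring
  rw [h1]
  linarith

lemma corrInt_one_zero_zero (hρ : IsActivationLoss ρ) (γ : ℝ) : corrInt ρ γ 1 0 0 = 0 := by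
  have h1 : corrInt ρ γ 1 0 0 = gaussE γ (fun q => deriv ρ q * (q * deriv ρ (-q))) := by
    rw [corrInt, ← integral_gaussPair_fst]
    simp [hρ.envGrad_zero]
  rw [h1]
  refine gaussE_eq_zero_of_odd γ fun q => ?_
  rw [neg_neg]
  ring

lemma gaussE_pos {γ : ℝ} (hγ : 0 < γ) {F : ℝ → ℝ} (hF : Continuous F) (C : ℝ)
    (hC : ∀ q, |F q| ≤ C * (1 + q ^ 2)) (h0 : ∀ q, 0 ≤ F q) (hne : ∃ q, F q ≠ 0) :
    0 < gaussE γ F := by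
  have := isOpenPosMeasure_gaussianReal 0 (toNNReal_sq_ne_zero hγ)
  have hi : Integrable F (gaussianReal 0 (Real.toNNReal (γ ^ 2))) :=
    (((integrable_const 1).add (integrable_sq_gaussianReal _ _)).const_mul C).mono'
      hF.aestronglyMeasurable (Eventually.of_forall hC)
  refine lt_of_le_of_ne (integral_nonneg h0) fun h => ?_
  obtain ⟨q, hq⟩ := hne
  exact hq (eq_zero_of_integral_eq_zero hF hi h0 h.symm q)

lemma exists_deriv_two_ne_zero (hρ : IsActivationLoss ρ) :
    ∃ q, q ≠ 0 ∧ iteratedDeriv 2 ρ q ≠ 0 := by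
  by_contra! h
  -- Vanishing off the origin extends to the origin by continuity. The point `q ≠ 0` is needed for
  -- the positivity of `E[Q₁² ρ'']`.
  have hz : ∀ q, iteratedDeriv 2 ρ q = 0 := by
    have h1 : Set.EqOn (iteratedDeriv 2 ρ) (fun _ => 0) {0}ᶜ := fun q hq => h q hq
    have := Continuous.ext_on (dense_compl_singleton (0 : ℝ)) hρ.continuous_deriv_two
      continuous_const h1
    exact congrFun this
  obtain ⟨y, z, hyz⟩ := hρ.nonconstant
  exact hyz (is_const_of_deriv_eq_zero (fun x => (hρ.hasDerivAt_deriv x).differentiableAt)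
    (fun x => by rw [(hρ.hasDerivAt_deriv x).deriv, hz x]) y z)

lemma gaussE_sq_mul_deriv_two_pos (hρ : IsActivationLoss ρ) {γ : ℝ} (hγ : 0 < γ) :
    0 < gaussE γ (fun q => q ^ 2 * iteratedDeriv 2 ρ q) := by
  obtain ⟨M, hM0, hM⟩ := hρ.exists_bound_two
  obtain ⟨q, hq, hq'⟩ := hρ.exists_deriv_two_ne_zero
  have c2 := hρ.continuous_deriv_two
  refine gaussE_pos hγ (by fun_prop) M (fun q => ?_)
    (fun q => mul_nonneg (sq_nonneg q) (hρ.deriv_two_nonneg q))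
    ⟨q, mul_ne_zero (pow_ne_zero 2 hq) hq'⟩
  rw [abs_mul, abs_of_nonneg (sq_nonneg q)]
  nlinarith [hM q, sq_nonneg q]

lemma gaussE_deriv_two_pos (hρ : IsActivationLoss ρ) {γ : ℝ} (hγ : 0 < γ) :
    0 < gaussE γ (fun q => iteratedDeriv 2 ρ q) := by
  obtain ⟨M, hM0, hM⟩ := hρ.exists_bound_two
  obtain ⟨q, hq, hq'⟩ := hρ.exists_deriv_two_ne_zero
  have c2 := hρ.continuous_deriv_two
  refine gaussE_pos hγ (by fun_prop) M (fun q => ?_) hρ.deriv_two_nonneg ⟨q, hq'⟩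
  nlinarith [hM q, sq_nonneg q]

lemma gaussE_deriv_mul_deriv_neg_pos (hρ : IsActivationLoss ρ) {γ : ℝ} (hγ : 0 < γ) :
    0 < gaussE γ (fun q => deriv ρ q * deriv ρ (-q)) := by
  have c1 := hρ.continuous_deriv
  refine gaussE_pos hγ (by fun_prop) 1 (fun q => ?_)
    (fun q => mul_nonneg (hρ.mem_unit _).1 (hρ.mem_unit _).1) ⟨0, ?_⟩
  · rw [abs_mul]
    calc |deriv ρ q| * |deriv ρ (-q)| ≤ 1 * 1 := by
          gcongr
          · exact hρ.abs_deriv_le_one _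
          · exact hρ.abs_deriv_le_one _
      _ ≤ 1 * (1 + q ^ 2) := by linarith [sq_nonneg q]
  · rw [neg_zero, hρ.deriv_zero]
    norm_num

end IsActivationLoss

/-! ### Strict monotonicity in the direction and uniqueness -/

namespace IsActivationLoss

variable {ρ : ℝ → ℝ}

lemma integrable_corr (hρ : IsActivationLoss ρ) (γ α s l : ℝ) :
    Integrable (fun x : ℝ × ℝ => deriv ρ x.1 * (x.1 * envGrad ρ l (-α * x.1 + s * x.2)))
      (gaussPair γ) := by
  have c1 := hρ.continuous_deriv
  have c2 := hρ.continuous_envGrad l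
  refine integrable_gaussPair_of_le (by fun_prop) 1 fun x => ?_
  rw [abs_mul, abs_mul]
  calc |deriv ρ x.1| * (|x.1| * |envGrad ρ l (-α * x.1 + s * x.2)|)
      ≤ 1 * ((1 + x.1 ^ 2) * 1) := by
        gcongr
        · exact hρ.abs_deriv_le_one _
        · exact abs_le_one_add_sq _
        · exact hρ.abs_envGrad_le_one _ _
    _ ≤ 1 * ((1 + x.1 ^ 2) * (1 + x.2 ^ 2)) := by
        gcongr
        linarith [sq_nonneg x.2]

lemma integrable_snd_mul_envGrad (hρ : IsActivationLoss ρ) (γ α s l : ℝ) :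
    Integrable (fun x : ℝ × ℝ => 2 * deriv ρ x.1 * (x.2 * envGrad ρ l (-α * x.1 + s * x.2)))
      (gaussPair γ) := by
  have c1 := hρ.continuous_deriv
  have c2 := hρ.continuous_envGrad l
  refine integrable_gaussPair_of_le (by fun_prop) 2 fun x => ?_
  rw [abs_mul, abs_mul, abs_mul, abs_two]
  calc 2 * |deriv ρ x.1| * (|x.2| * |envGrad ρ l (-α * x.1 + s * x.2)|)
      ≤ 2 * 1 * ((1 + x.2 ^ 2) * 1) := by
        gcongr
        · exact hρ.abs_deriv_le_one _
        · exact abs_le_one_add_sq _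
        · exact hρ.abs_envGrad_le_one _ _
    _ ≤ 2 * ((1 + x.1 ^ 2) * (1 + x.2 ^ 2)) := by nlinarith [sq_nonneg x.1, sq_nonneg x.2]

lemma integrable_envGrad_mul (hρ : IsActivationLoss ρ) (γ α s l α' s' l' : ℝ) :
    Integrable (fun x : ℝ × ℝ => 2 * deriv ρ x.1 *
      (envGrad ρ l (-α * x.1 + s * x.2) * envGrad ρ l' (-α' * x.1 + s' * x.2)))
      (gaussPair γ) := by
  have c1 := hρ.continuous_deriv
  have c2 := hρ.continuous_envGrad l
  have c3 := hρ.continuous_envGrad l'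
  refine integrable_bounded_gaussPair (by fun_prop) (2 * 1 * (1 * 1)) fun x => ?_
  rw [abs_mul, abs_mul, abs_mul, abs_two]
  gcongr
  · exact hρ.abs_deriv_le_one _
  · exact hρ.abs_envGrad_le_one _ _
  · exact hρ.abs_envGrad_le_one _ _

/-- The envelope Hessian is the derivative of the envelope gradient, so Stein's identity links the
energy and slope equations. -/
lemma integral_snd_mul_envGrad (hρ : IsActivationLoss ρ) (γ α s l : ℝ) :
    ∫ x, 2 * deriv ρ x.1 * (x.2 * envGrad ρ l (-α * x.1 + s * x.2)) ∂gaussPair γ =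
      s * slopeInt ρ γ α s l := by
  obtain ⟨M, hM0, hM⟩ := hρ.exists_bound_two
  have c1 := hρ.continuous_deriv
  refine integral_gaussPair_mul_snd (w := fun q => 2 * deriv ρ q) (W := 2) (by fun_prop)
    (fun q => ?_) (hρ.hasDerivAt_envGrad l) (hρ.continuous_envHess l) (hρ.abs_envGrad_le_one l)
    (hρ.abs_envHess_le hM l)
  rw [abs_mul, abs_two]
  linarith [hρ.abs_deriv_le_one q]

/-- The correlation functional is strictly decreasing in the direction parameter. -/
lemma corrInt_lt_corrInt (hρ : IsActivationLoss ρ) {γ α α' s l : ℝ} (hγ : 0 < γ) (hα : α < α')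
    (h : s ≠ 0 ∨ (l = 0 ∧ 0 < α)) : corrInt ρ γ α' s l < corrInt ρ γ α s l := by
  have := isOpenPosMeasure_gaussPair hγ
  have c1 := hρ.continuous_deriv
  have c2 := hρ.continuous_envGrad l
  have i1 := hρ.integrable_corr γ α s l
  have i2 := hρ.integrable_corr γ α' s l
  -- Raising `α` moves the argument against the sign of `q`, so `F` is nonnegative; equality of the
  -- integrals would force `F` to vanish identically.
  set F : ℝ × ℝ → ℝ := fun x => deriv ρ x.1 * (x.1 * envGrad ρ l (-α * x.1 + s * x.2)) -
    deriv ρ x.1 * (x.1 * envGrad ρ l (-α' * x.1 + s * x.2)) with hF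
  have hF0 : ∀ x, 0 ≤ F x := by
    intro x
    rw [hF]
    simp only
    rw [← mul_sub, ← mul_sub]
    refine mul_nonneg (hρ.mem_unit _).1 ?_
    rcases le_total 0 x.1 with hx | hx
    · refine mul_nonneg hx (sub_nonneg.2 (hρ.monotone_envGrad l ?_))
      nlinarith
    · refine mul_nonneg_of_nonpos_of_nonpos hx (sub_nonpos.2 (hρ.monotone_envGrad l ?_))
      nlinarith
  have hintegral : ∫ x, F x ∂gaussPair γ = corrInt ρ γ α s l - corrInt ρ γ α' s l :=
    integral_sub i1 i2
  have hle : 0 ≤ ∫ x, F x ∂gaussPair γ := integral_nonneg hF0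
  rcases hle.lt_or_eq with hlt | heq
  · linarith
  exfalso
  have hz := eq_zero_of_integral_eq_zero (by fun_prop) (show Integrable F _ from i1.sub i2) hF0 heq.symm
  have key : ∀ q z : ℝ, 0 < q →
      envGrad ρ l (-α * q + s * z) = envGrad ρ l (-α' * q + s * z) := by
    intro q z hq
    have := hz (q, z)
    rw [hF] at this
    simp only at this
    rw [← mul_sub, ← mul_sub] at this
    have h1 := (mul_eq_zero.1 this).resolve_left (hρ.deriv_pos_of_nonneg hq.le).ne'
    linarith [(mul_eq_zero.1 h1).resolve_left hq.ne']
  rcases h with hs | ⟨rfl, hα0⟩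
  · have hlt : ∀ x y, x < y → envGrad ρ l y = envGrad ρ l x := by
      intro x y hxy
      have hd : α' - α ≠ 0 := by linarith
      -- This `(q, z)` sends the two linear forms to `y` and `x`, so the envelope gradient would be
      -- constant.
      have := key ((y - x) / (α' - α)) ((y + α * ((y - x) / (α' - α))) / s)
        (div_pos (by linarith) (by linarith))
      rw [mul_div_cancel₀ _ hs] at this
      have e1 : -α * ((y - x) / (α' - α)) + (y + α * ((y - x) / (α' - α))) = y := by ring
      have e2 : -α' * ((y - x) / (α' - α)) + (y + α * ((y - x) / (α' - α))) = x := by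
        field_simp
        ring
      rwa [e1, e2] at this
    refine hρ.not_envGrad_const l fun x y => ?_
    rcases lt_trichotomy x y with hxy | rfl | hxy
    · exact (hlt x y hxy).symm
    · rfl
    · exact hlt y x hxy
  · have hα' : 0 < α' := hα0.trans hα
    have hneg : ∀ q, 0 < q → deriv ρ (-α * q) = deriv ρ (-α' * q) := by
      intro q hq
      simpa [hρ.envGrad_zero] using key q 0 hq
    have hall : ∀ q, deriv ρ (α * q) = deriv ρ (α' * q) := by
      intro q
      rcases lt_trichotomy q 0 with hq | rfl | hq
      · have := hneg (-q) (by linarith)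
        simpa using this
      · simp
      · have := hneg q hq
        rw [neg_mul, neg_mul, hρ.deriv_neg, hρ.deriv_neg] at this
        linarith
    -- With `l = 0`, equality at `z = 0` is invariance under dilation by `α / α'`.
    have hc := hρ.dilation_eq_one (div_pos hα0 hα') fun x => by
      have := hall (x / α')
      rw [mul_div_cancel₀ _ hα'.ne'] at this
      rw [← this]
      congr 1
      ring
    rw [div_eq_one_iff_eq hα'.ne'] at hc
    linarith

/-- If two envelope gradients agree along two linear forms on a half-plane and the parameters are
in the ratio of the `z`-coefficients, the forms and the parameters agree. -/
lemma eq_of_envGrad_eq (hρ : IsActivationLoss ρ) {α s l α' s' l' : ℝ} (hs : 0 < s) (hs' : 0 < s')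
    (hl : 0 < l) (hl' : 0 < l') (hr : l * s' = l' * s)
    (h : ∀ q z : ℝ, 0 < q →
      envGrad ρ l (-α * q + s * z) = envGrad ρ l' (-α' * q + s' * z)) :
    α = α' ∧ s = s' ∧ l = l' := by
  -- Take the second linear form `y` as coordinate in place of `z`. The right side is then
  -- independent of `q`.
  have key : ∀ q y : ℝ, 0 < q →
      envGrad ρ l (s / s' * y + (s / s' * α' - α) * q) = envGrad ρ l' y := by
    intro q y hq
    have := h q ((y + α' * q) / s') hq
    convert this using 2
    · field_simp
      ring
    · field_simp
      ring
  have hc : 0 < s / s' := div_pos hs hs'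
  set c := s / s' with hcdef
  have hd : c * α' - α = 0 := by
    by_contra hd
    refine hρ.not_envGrad_const l fun x y => ?_
    set d := c * α' - α
    -- Two positive values of `q` that differ by `(y - x) / d` move the argument from `x` to `y`.
    have hq : 0 < 1 + |(y - x) / d| := by positivity
    have hq' : 0 < 1 + |(y - x) / d| + (y - x) / d := by
      linarith [neg_abs_le ((y - x) / d)]
    have h1 := key _ ((x - d * (1 + |(y - x) / d|)) / c) hq
    have h2 := key _ ((x - d * (1 + |(y - x) / d|)) / c) hq'
    rw [mul_div_cancel₀ _ hc.ne'] at h1 h2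
    have e1 : x - d * (1 + |(y - x) / d|) + d * (1 + |(y - x) / d|) = x := by ring
    have e2 : x - d * (1 + |(y - x) / d|) + d * (1 + |(y - x) / d| + (y - x) / d) = y := by
      have : d * ((y - x) / d) = y - x := mul_div_cancel₀ _ hd
      linear_combination this
    rw [e1] at h1
    rw [e2] at h2
    rw [h1, h2]
  have hl1 : l = c * l' := by
    rw [hcdef]
    field_simp
    linarith
  have hc1 : c = 1 := by
    refine hρ.dilation_eq_one hc fun p => ?_
    -- At this argument the proximal points are `p` and, since `l = c l'`, `c p`. Hence `ρ'(c p) =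
    -- ρ'(p)`.
    have h1 := key 1 (p + |l'| * deriv ρ p) one_pos
    rw [hd, zero_mul, add_zero, hρ.envGrad_add_mul_deriv] at h1
    have h2 := hρ.prox_abs_eq_sub l (c * (p + |l'| * deriv ρ p))
    rw [h1, abs_of_pos hl, abs_of_pos hl', hl1] at h2
    have h3 : prox (c * l') ρ (c * (p + l' * deriv ρ p)) = c * p := by
      rw [h2]
      ring
    rw [envGrad, abs_of_pos hl, abs_of_pos hl', hl1, h3] at h1
    exact h1
  refine ⟨?_, ?_, ?_⟩
  · rw [hc1] at hd
    linarith
  · rwa [hcdef, div_eq_one_iff_eq hs'.ne'] at hc1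
  · rw [hl1, hc1, one_mul]

/-- Uniqueness: two solutions of the system whose parameters `κ` and `l` are not strictly ordered
in the same way coincide. -/
lemma eq_of_reducedSystem (hρ : IsActivationLoss ρ) {γ κ α s l κ' α' s' l' : ℝ} (hγ : 0 < γ)
    (hs : 0 < s) (hs' : 0 < s') (hl : 0 < l) (hl' : 0 < l')
    (h : ReducedSystem ρ γ κ α s l) (h' : ReducedSystem ρ γ κ' α' s' l')
    (hord : (κ - κ') * (l - l') ≤ 0) : α = α' ∧ s = s' ∧ l = l' := by
  have := isOpenPosMeasure_gaussPair hγ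
  have c0 := hρ.continuous_deriv
  have c1 := hρ.continuous_envGrad l
  have c2 := hρ.continuous_envGrad l'
  set H : ℝ × ℝ → ℝ := fun x => envGrad ρ l (-α * x.1 + s * x.2) with hH
  set H' : ℝ × ℝ → ℝ := fun x => envGrad ρ l' (-α' * x.1 + s' * x.2) with hH'
  have cH : Continuous H := by fun_prop
  have cH' : Continuous H' := by fun_prop
  have q1 : Integrable (fun x => deriv ρ x.1 * (x.1 * H x)) (gaussPair γ) :=
    hρ.integrable_corr γ α s l
  have q2 : Integrable (fun x => deriv ρ x.1 * (x.1 * H' x)) (gaussPair γ) :=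
    hρ.integrable_corr γ α' s' l'
  have z1 : Integrable (fun x => 2 * deriv ρ x.1 * (x.2 * H x)) (gaussPair γ) :=
    hρ.integrable_snd_mul_envGrad γ α s l
  have z2 : Integrable (fun x => 2 * deriv ρ x.1 * (x.2 * H' x)) (gaussPair γ) :=
    hρ.integrable_snd_mul_envGrad γ α' s' l'
  have e1 : Integrable (fun x => 2 * deriv ρ x.1 * (H x * H x)) (gaussPair γ) :=
    hρ.integrable_envGrad_mul γ α s l α s l
  have e2 : Integrable (fun x => 2 * deriv ρ x.1 * (H' x * H' x)) (gaussPair γ) :=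
    hρ.integrable_envGrad_mul γ α' s' l' α' s' l'
  have e3 : Integrable (fun x => 2 * deriv ρ x.1 * (H x * H' x)) (gaussPair γ) :=
    hρ.integrable_envGrad_mul γ α s l α' s' l'
  have Iq1 : ∫ x, deriv ρ x.1 * (x.1 * H x) ∂gaussPair γ = 0 := h.corr
  have Iq2 : ∫ x, deriv ρ x.1 * (x.1 * H' x) ∂gaussPair γ = 0 := h'.corr
  have Iz1 : ∫ x, 2 * deriv ρ x.1 * (x.2 * H x) ∂gaussPair γ = s * slopeInt ρ γ α s l :=
    hρ.integral_snd_mul_envGrad γ α s l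
  have Iz2 : ∫ x, 2 * deriv ρ x.1 * (x.2 * H' x) ∂gaussPair γ = s' * slopeInt ρ γ α' s' l' :=
    hρ.integral_snd_mul_envGrad γ α' s' l'
  have Ie1 : ∫ x, 2 * deriv ρ x.1 * (H x * H x) ∂gaussPair γ = energyInt ρ γ α s l := by
    simp only [energyInt, hH, ← sq]
  have Ie2 : ∫ x, 2 * deriv ρ x.1 * (H' x * H' x) ∂gaussPair γ = energyInt ρ γ α' s' l' := by
    simp only [energyInt, hH', ← sq]
  set X := ∫ x, 2 * deriv ρ x.1 * (H x * H' x) ∂gaussPair γ with hX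
  have hE := h.energy
  have hE' := h'.energy
  have hS := h.slope
  have hS' := h'.slope
  set B := energyInt ρ γ α s l
  set B' := energyInt ρ γ α' s' l'
  set C := slopeInt ρ γ α s l
  set C' := slopeInt ρ γ α' s' l'
  -- The second factor is the difference of the proximal points, and `H`, `H'` are `ρ'` at these
  -- points, so monotonicity gives `F ≥ 0`.
  set F : ℝ × ℝ → ℝ := fun x => 2 * deriv ρ x.1 * ((H x - H' x) *
    ((-α * x.1 + s * x.2 - l * H x) - (-α' * x.1 + s' * x.2 - l' * H' x))) with hF
  have hFe : F = fun x => 2 * (α' - α) * (deriv ρ x.1 * (x.1 * H x)) +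
      (-2 * (α' - α)) * (deriv ρ x.1 * (x.1 * H' x)) +
      (s - s') * (2 * deriv ρ x.1 * (x.2 * H x)) +
      (-(s - s')) * (2 * deriv ρ x.1 * (x.2 * H' x)) +
      (-l) * (2 * deriv ρ x.1 * (H x * H x)) + (-l') * (2 * deriv ρ x.1 * (H' x * H' x)) +
      (l + l') * (2 * deriv ρ x.1 * (H x * H' x)) := by
    ext x
    rw [hF]
    ring
  have p1 := (q1.const_mul (2 * (α' - α))).fun_add (q2.const_mul (-2 * (α' - α)))
  have p2 := p1.fun_add (z1.const_mul (s - s'))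
  have p3 := p2.fun_add (z2.const_mul (-(s - s')))
  have p4 := p3.fun_add (e1.const_mul (-l))
  have p5 := p4.fun_add (e2.const_mul (-l'))
  have p6 := p5.fun_add (e3.const_mul (l + l'))
  have hFi : Integrable F (gaussPair γ) := by
    rw [hFe]
    exact p6
  have hFint : ∫ x, F x ∂gaussPair γ =
      (s - s') * (s * C) - (s - s') * (s' * C') - l * B - l' * B' + (l + l') * X := by
    simp only [hFe]
    rw [integral_add p5 (e3.const_mul _), integral_add p4 (e2.const_mul _),
      integral_add p3 (e1.const_mul _), integral_add p2 (z2.const_mul _),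
      integral_add p1 (z1.const_mul _), integral_add (q1.const_mul _) (q2.const_mul _)]
    simp only [integral_const_mul, Iq1, Iq2, Iz1, Iz2, Ie1, Ie2, ← hX]
    ring
  have hv : ∀ x : ℝ × ℝ, prox l ρ (-α * x.1 + s * x.2) = -α * x.1 + s * x.2 - l * H x := by
    intro x
    have := hρ.prox_abs_eq_sub l (-α * x.1 + s * x.2)
    rwa [abs_of_pos hl] at this
  have hv' : ∀ x : ℝ × ℝ,
      prox l' ρ (-α' * x.1 + s' * x.2) = -α' * x.1 + s' * x.2 - l' * H' x := by
    intro x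
    have := hρ.prox_abs_eq_sub l' (-α' * x.1 + s' * x.2)
    rwa [abs_of_pos hl'] at this
  have hHv : ∀ x : ℝ × ℝ, H x = deriv ρ (-α * x.1 + s * x.2 - l * H x) := by
    intro x
    rw [← hv x, hH]
    simp only [envGrad, abs_of_pos hl]
  have hHv' : ∀ x : ℝ × ℝ, H' x = deriv ρ (-α' * x.1 + s' * x.2 - l' * H' x) := by
    intro x
    rw [← hv' x, hH']
    simp only [envGrad, abs_of_pos hl']
  have hF0 : ∀ x, 0 ≤ F x := by
    intro x
    refine mul_nonneg (mul_nonneg zero_le_two (hρ.mem_unit _).1) ?_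
    have a1 := hHv x
    have a2 := hHv' x
    rcases le_total (-α * x.1 + s * x.2 - l * H x) (-α' * x.1 + s' * x.2 - l' * H' x) with hx | hx
    · refine mul_nonneg_of_nonpos_of_nonpos ?_ (sub_nonpos.2 hx)
      rw [a1, a2]
      exact sub_nonpos.2 (hρ.monotone hx)
    · refine mul_nonneg ?_ (sub_nonneg.2 hx)
      rw [a1, a2]
      exact sub_nonneg.2 (hρ.monotone hx)
  -- The weights `l s'` and `l' s` turn the two energies into `κ` and `κ'` up to the common factor
  -- `(s s')²`.
  set G : ℝ × ℝ → ℝ := fun x => 2 * deriv ρ x.1 * (l * s' * H x - l' * s * H' x) ^ 2 with hG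
  have hGe : G = fun x => (l * s') ^ 2 * (2 * deriv ρ x.1 * (H x * H x)) +
      (l' * s) ^ 2 * (2 * deriv ρ x.1 * (H' x * H' x)) +
      (-2 * (l * s') * (l' * s)) * (2 * deriv ρ x.1 * (H x * H' x)) := by
    ext x
    rw [hG]
    ring
  have r1 := (e1.const_mul ((l * s') ^ 2)).fun_add (e2.const_mul ((l' * s) ^ 2))
  have r2 := r1.fun_add (e3.const_mul (-2 * (l * s') * (l' * s)))
  have hGi : Integrable G (gaussPair γ) := by
    rw [hGe]
    exact r2
  have hGint : ∫ x, G x ∂gaussPair γ =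
      (l * s') ^ 2 * B + (l' * s) ^ 2 * B' - 2 * (l * s') * (l' * s) * X := by
    simp only [hGe]
    rw [integral_add r1 (e3.const_mul _),
      integral_add (e1.const_mul _) (e2.const_mul _)]
    simp only [integral_const_mul, Ie1, Ie2, ← hX]
    ring
  have hG0 : ∀ x, 0 ≤ G x := fun x =>
    mul_nonneg (mul_nonneg zero_le_two (hρ.mem_unit _).1) (sq_nonneg _)
  have hFn : 0 ≤ ∫ x, F x ∂gaussPair γ := integral_nonneg hF0
  have hGn : 0 ≤ ∫ x, G x ∂gaussPair γ := integral_nonneg hG0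
  have hlB : l * B = s ^ 2 * C := by
    have : l * (l * B) = l * (s ^ 2 * C) := by
      rw [hS] at hE
      linear_combination -hE
    exact mul_left_cancel₀ hl.ne' this
  have hlB' : l' * B' = s' ^ 2 * C' := by
    have : l' * (l' * B') = l' * (s' ^ 2 * C') := by
      rw [hS'] at hE'
      linear_combination -hE'
    exact mul_left_cancel₀ hl'.ne' this
  have hF2 : ∫ x, F x ∂gaussPair γ = (l + l') * X - s * s' * (C + C') := by
    rw [hFint]
    linear_combination -hlB - hlB'
  have hG2 : ∫ x, G x ∂gaussPair γ = s * s' * (s * s' * (κ + κ') - 2 * (l * l') * X) := by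
    rw [hGint]
    linear_combination (-s' ^ 2) * hE - s ^ 2 * hE'
  have hss : 0 < s * s' := mul_pos hs hs'
  have hll : 0 < l * l' := mul_pos hl hl'
  -- The multipliers cancel the cross term `X`, which no equation controls; `κ = l C` and `κ' = l'
  -- C'` leave the product of differences.
  have hcomb : 2 * (l * l') * (∫ x, F x ∂gaussPair γ) * (s * s') +
      (l + l') * ∫ x, G x ∂gaussPair γ = (s * s') ^ 2 * ((κ - κ') * (l - l')) := by
    rw [hF2, hG2, hS, hS']
    ring
  have hle : (s * s') ^ 2 * ((κ - κ') * (l - l')) ≤ 0 :=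
    mul_nonpos_of_nonneg_of_nonpos (sq_nonneg _) hord
  have hFz : ∫ x, F x ∂gaussPair γ = 0 := by
    refine le_antisymm ?_ hFn
    by_contra! hpos
    have : 0 < 2 * (l * l') * (∫ x, F x ∂gaussPair γ) * (s * s') := by positivity
    have : 0 ≤ (l + l') * ∫ x, G x ∂gaussPair γ := by positivity
    linarith
  have hGz : ∫ x, G x ∂gaussPair γ = 0 := by
    refine le_antisymm ?_ hGn
    by_contra! hpos
    have : 0 < (l + l') * ∫ x, G x ∂gaussPair γ := by positivity
    have : 0 ≤ 2 * (l * l') * (∫ x, F x ∂gaussPair γ) * (s * s') := by positivity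
    linarith
  have hFx := eq_zero_of_integral_eq_zero (by fun_prop) hFi hF0 hFz
  have hGx := eq_zero_of_integral_eq_zero (by fun_prop) hGi hG0 hGz
  have hHH : ∀ q z : ℝ, 0 < q → H (q, z) = H' (q, z) := by
    intro q z hq
    have h1 := (mul_eq_zero.1 (hFx (q, z))).resolve_left
      (mul_pos two_pos (hρ.deriv_pos_of_nonneg hq.le)).ne'
    -- Equal proximal points also give equal gradients.
    rcases mul_eq_zero.1 h1 with h2 | h2
    · linarith
    · rw [hHv, hHv', sub_eq_zero.1 h2]
  refine hρ.eq_of_envGrad_eq hs hs' hl hl' ?_ hHH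
  -- The first linear form vanishes here. A zero gradient would put the proximal point at `0`,
  -- contradicting `ρ'(0) = 1/2`; so `G = 0` yields `l s' = l' s`.
  have hpos : 0 < H (1, α / s) := by
    have h1 : H (1, α / s) = envGrad ρ l 0 := by
      rw [hH]
      simp only
      rw [mul_div_cancel₀ _ hs.ne']
      congr 1
      ring
    rw [h1]
    refine lt_of_le_of_ne (hρ.envGrad_nonneg l 0) fun h0 => ?_
    have h2 := hρ.prox_abs_eq_sub l 0
    rw [← h0, mul_zero, sub_zero] at h2
    rw [envGrad, h2, hρ.deriv_zero] at h0
    norm_num at h0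
  have h1 := (mul_eq_zero.1 (hGx (1, α / s))).resolve_left
    (mul_pos two_pos (hρ.deriv_pos_of_nonneg zero_le_one)).ne'
  rw [sq_eq_zero_iff, ← hHH 1 _ one_pos, ← sub_mul] at h1
  linarith [(mul_eq_zero.1 h1).resolve_right hpos.ne']

end IsActivationLoss

/-! ### Existence for small `κ` -/

/-- A selection of a closed relation is continuous where it is the only choice in a compact set. -/
lemma continuousOn_of_unique_mem {X Y : Type*} [TopologicalSpace X] [TopologicalSpace Y]
    {S : Set X} {K : Set Y} (hK : IsCompact K) {Z : Set (X × Y)} (hZ : IsClosed Z) {g : X → Y}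
    (hg : ∀ x ∈ S, g x ∈ K) (hgZ : ∀ x ∈ S, (x, g x) ∈ Z)
    (huniq : ∀ x ∈ S, ∀ y ∈ K, (x, y) ∈ Z → y = g x) : ContinuousOn g S := by
  intro x hx
  rw [ContinuousWithinAt, tendsto_iff_ultrafilter]
  intro u hu
  have hS : ∀ᶠ a in (u : Filter X), a ∈ S := hu self_mem_nhdsWithin
  have hux : Tendsto id (u : Filter X) (𝓝 x) := hu.trans nhdsWithin_le_nhds
  have hKu : ((u.map g : Ultrafilter Y) : Filter Y) ≤ 𝓟 K := by
    rw [le_principal_iff]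
    exact hS.mono hg
  -- Compactness gives a limit along the ultrafilter, closedness keeps it in the relation, and
  -- uniqueness identifies it.
  obtain ⟨y, hy, hle⟩ := hK.ultrafilter_le_nhds (u.map g) hKu
  have hlim : Tendsto g u (𝓝 y) := hle
  have hmem : (x, y) ∈ Z :=
    hZ.mem_of_tendsto (hux.prodMk_nhds hlim) (hS.mono fun a ha => hgZ a ha)
  rwa [huniq x hx y hy hmem] at hlim

attribute [irreducible] corrInt energyInt slopeInt

namespace IsActivationLoss

variable {ρ : ℝ → ℝ}

/-- With `s² = l t`, eliminating `κ` leaves `A = 0` and `t C = B`, which stay nondegenerate as `l →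
0` with limit `α = 1`, `t = b / m`. -/
lemma exists_reduced_of_small_prox_parameter (hρ : IsActivationLoss ρ) {γ δ m b : ℝ} (hγ : 0 < γ)
    (hm : slopeInt ρ γ 1 0 0 = m) (hb : energyInt ρ γ 1 0 0 = b) (hm0 : 0 < m)
    (hδ : 0 < δ) (hδ1 : δ < 1) (hδt : δ < b / m) :
    ∃ l₁ > 0, ∀ l, 0 < l → l ≤ l₁ → ∃ α t, |α - 1| ≤ δ ∧ |t - b / m| ≤ δ ∧
      corrInt ρ γ α √(l * t) l = 0 ∧ t * slopeInt ρ γ α √(l * t) l = energyInt ρ γ α √(l * t) l ∧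
      |slopeInt ρ γ α √(l * t) l - m| ≤ δ := by
  have cA := hρ.continuous_corrInt γ
  have cB := hρ.continuous_energyInt γ
  have cC := hρ.continuous_slopeInt γ
  set t₀ := b / m with ht₀
  have hbt : b = m * t₀ := by rw [ht₀, mul_div_cancel₀ _ hm0.ne']
  have hD : 0 < t₀ + δ + 1 := by linarith
  -- If `C` and `B` are within `η` of `m` and `b`, then `t C - B` changes sign between `t₀ - δ` and
  -- `t₀ + δ`.
  set η := min δ (m * δ / (2 * (t₀ + δ + 1))) with hη
  have hη0 : 0 < η := by positivity
  have hηδ : η ≤ δ := min_le_left _ _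
  have hηm : η * (t₀ + δ + 1) < m * δ := by
    have h1 : η ≤ m * δ / (2 * (t₀ + δ + 1)) := min_le_right _ _
    rw [le_div_iff₀ (by positivity)] at h1
    nlinarith [mul_pos hη0 hD]
  have hev : ∀ᶠ u : ℝ × ℝ × ℝ in 𝓝 (1, 0, 0),
      |slopeInt ρ γ u.1 u.2.1 u.2.2 - m| < η ∧ |energyInt ρ γ u.1 u.2.1 u.2.2 - b| < η := by
    have e1 : Tendsto (fun u : ℝ × ℝ × ℝ => slopeInt ρ γ u.1 u.2.1 u.2.2) (𝓝 (1, 0, 0)) (𝓝 m) :=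
      hm ▸ cC.tendsto (1, 0, 0)
    have e2 : Tendsto (fun u : ℝ × ℝ × ℝ => energyInt ρ γ u.1 u.2.1 u.2.2) (𝓝 (1, 0, 0)) (𝓝 b) :=
      hb ▸ cB.tendsto (1, 0, 0)
    exact (e1.eventually (Metric.ball_mem_nhds m hη0)).and
      (e2.eventually (Metric.ball_mem_nhds b hη0))
  obtain ⟨r, hr0, hr⟩ := Metric.eventually_nhds_iff.1 hev
  set δ' := min δ (r / 2) with hδ'
  have hδ'0 : 0 < δ' := by positivity
  have hδ'1 : δ' < 1 := (min_le_left _ _).trans_lt hδ1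
  have hδ'r : δ' < r := (min_le_right _ _).trans_lt (by linarith)
  have h0 := hρ.corrInt_one_zero_zero γ
  have hneg : corrInt ρ γ (1 + δ') 0 0 < 0 :=
    (hρ.corrInt_lt_corrInt hγ (by linarith) (Or.inr ⟨rfl, one_pos⟩)).trans_eq h0
  have hpos : 0 < corrInt ρ γ (1 - δ') 0 0 :=
    h0.symm.trans_lt (hρ.corrInt_lt_corrInt hγ (by linarith) (Or.inr ⟨rfl, by linarith⟩))
  have hev2 : ∀ᶠ u : ℝ × ℝ in 𝓝 (0, 0),
      corrInt ρ γ (1 + δ') u.1 u.2 < 0 ∧ 0 < corrInt ρ γ (1 - δ') u.1 u.2 := by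
    have e1 := (cA.comp (Continuous.prodMk_right (1 + δ'))).tendsto (0, 0) |>.eventually
      (gt_mem_nhds hneg)
    have e2 := (cA.comp (Continuous.prodMk_right (1 - δ'))).tendsto (0, 0) |>.eventually
      (lt_mem_nhds hpos)
    exact e1.and e2
  obtain ⟨r', hr'0, hr'⟩ := Metric.eventually_nhds_iff.1 hev2
  set R := min r r' / 2 with hR
  have hR0 : 0 < R := by positivity
  have hRr : R < r := by
    have := min_le_left r r'
    rw [hR]
    linarith
  have hRr' : R < r' := by
    have := min_le_right r r'
    rw [hR]
    linarith
  have htδ : 0 < t₀ + δ := by linarith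
  -- The second bound gives `√(l t) ≤ R` for all `t ≤ t₀ + δ`.
  refine ⟨min R (R ^ 2 / (t₀ + δ)), by positivity, fun l hl hle => ?_⟩
  have hlR : |l| ≤ R := by
    rw [abs_of_pos hl]
    exact hle.trans (min_le_left _ _)
  have hT : ∀ t ∈ Set.Icc (t₀ - δ) (t₀ + δ), 0 < √(l * t) ∧ |√(l * t)| ≤ R := by
    intro t ht
    have htpos : 0 < t := by linarith [ht.1]
    refine ⟨Real.sqrt_pos.2 (mul_pos hl htpos), ?_⟩
    rw [abs_of_nonneg (Real.sqrt_nonneg _), Real.sqrt_le_left hR0.le]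
    have h1 := hle.trans (min_le_right _ _)
    rw [le_div_iff₀ htδ] at h1
    exact (mul_le_mul_of_nonneg_left ht.2 hl.le).trans h1
  have hnear : ∀ α ∈ Set.Icc (1 - δ') (1 + δ'), ∀ t ∈ Set.Icc (t₀ - δ) (t₀ + δ),
      |slopeInt ρ γ α √(l * t) l - m| < η ∧ |energyInt ρ γ α √(l * t) l - b| < η := by
    intro α hα t ht
    refine hr (y := (α, √(l * t), l)) ?_
    rw [Prod.dist_eq, Prod.dist_eq, Real.dist_eq, Real.dist_eq, Real.dist_eq]
    simp only [sub_zero]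
    refine max_lt ?_ (max_lt ((hT t ht).2.trans_lt hRr) (hlR.trans_lt hRr))
    rw [abs_lt]
    constructor <;> linarith [hα.1, hα.2]
  have hroot : ∀ t ∈ Set.Icc (t₀ - δ) (t₀ + δ),
      ∃ α ∈ Set.Icc (1 - δ') (1 + δ'), corrInt ρ γ α √(l * t) l = 0 := by
    intro t ht
    have hsign := hr' (y := (√(l * t), l)) (by
      rw [Prod.dist_eq, Real.dist_eq, Real.dist_eq]
      simp only [sub_zero]
      exact max_lt ((hT t ht).2.trans_lt hRr') (hlR.trans_lt hRr'))
    have hc : Continuous fun α => corrInt ρ γ α √(l * t) l :=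
      cA.comp (by fun_prop : Continuous fun α : ℝ => (α, √(l * t), l))
    exact intermediate_value_Icc' (by linarith : 1 - δ' ≤ 1 + δ') hc.continuousOn
      ⟨hsign.1.le, hsign.2.le⟩
  choose! a ha haz using hroot
  -- Since `s > 0`, strict monotonicity makes the root in `α` unique, hence continuous in `t`.
  have hac : ContinuousOn a (Set.Icc (t₀ - δ) (t₀ + δ)) := by
    refine continuousOn_of_unique_mem (isCompact_Icc (a := 1 - δ') (b := 1 + δ'))
      (Z := {x : ℝ × ℝ | corrInt ρ γ x.2 √(l * x.1) l = 0}) ?_ ha haz ?_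
    · exact isClosed_eq (cA.comp
        (by fun_prop : Continuous fun x : ℝ × ℝ => (x.2, √(l * x.1), l))) continuous_const
    · intro t ht α _ hα
      have hα' : corrInt ρ γ α √(l * t) l = 0 := hα
      have hs : √(l * t) ≠ 0 := (hT t ht).1.ne'
      rcases lt_trichotomy α (a t) with h | h | h
      · have := hρ.corrInt_lt_corrInt hγ h (l := l) (Or.inl hs)
        rw [hα', haz t ht] at this
        exact absurd this (lt_irrefl 0)
      · exact h
      · have := hρ.corrInt_lt_corrInt hγ h (l := l) (Or.inl hs)
        rw [hα', haz t ht] at this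
        exact absurd this (lt_irrefl 0)
  have hpath : ContinuousOn (fun t => ((a t, √(l * t), l) : ℝ × ℝ × ℝ))
      (Set.Icc (t₀ - δ) (t₀ + δ)) :=
    hac.prodMk (by fun_prop : Continuous fun t : ℝ => (√(l * t), l)).continuousOn
  have hGc : ContinuousOn
      (fun t => t * slopeInt ρ γ (a t) √(l * t) l - energyInt ρ γ (a t) √(l * t) l)
      (Set.Icc (t₀ - δ) (t₀ + δ)) :=
    (continuousOn_id.mul (cC.comp_continuousOn hpath)).sub (cB.comp_continuousOn hpath)
  have hleft : t₀ - δ ∈ Set.Icc (t₀ - δ) (t₀ + δ) := ⟨le_rfl, by linarith⟩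
  have hright : t₀ + δ ∈ Set.Icc (t₀ - δ) (t₀ + δ) := ⟨by linarith, le_rfl⟩
  have hL : (t₀ - δ) * slopeInt ρ γ (a (t₀ - δ)) √(l * (t₀ - δ)) l -
      energyInt ρ γ (a (t₀ - δ)) √(l * (t₀ - δ)) l ≤ 0 := by
    obtain ⟨h1, h2⟩ := hnear _ (ha _ hleft) _ hleft
    have h3 := (abs_lt.1 h1).2
    have h4 := (abs_lt.1 h2).1
    nlinarith
  have hRt : 0 ≤ (t₀ + δ) * slopeInt ρ γ (a (t₀ + δ)) √(l * (t₀ + δ)) l -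
      energyInt ρ γ (a (t₀ + δ)) √(l * (t₀ + δ)) l := by
    obtain ⟨h1, h2⟩ := hnear _ (ha _ hright) _ hright
    have h3 := (abs_lt.1 h1).1
    have h4 := (abs_lt.1 h2).2
    nlinarith
  obtain ⟨t, ht, hzero⟩ := intermediate_value_Icc (by linarith : t₀ - δ ≤ t₀ + δ) hGc ⟨hL, hRt⟩
  refine ⟨a t, t, ?_, ?_, haz t ht, sub_eq_zero.1 hzero,
    ((hnear _ (ha t ht) t ht).1.le).trans hηδ⟩
  · have h1 := ha t ht
    have h2 := min_le_left δ (r / 2)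
    rw [abs_le]
    constructor <;> linarith [h1.1, h1.2]
  · rw [abs_le]
    constructor <;> linarith [ht.1, ht.2]

/-- Each small `l` solves the system for the value `κ = l C`; this value varies continuously with
`l` and is at most `l (m + δ)`, so it reaches every small `κ`. -/
lemma exists_reduced_of_small (hρ : IsActivationLoss ρ) {γ δ m b : ℝ} (hγ : 0 < γ)
    (hm : slopeInt ρ γ 1 0 0 = m) (hb : energyInt ρ γ 1 0 0 = b)
    (hδ : 0 < δ) (hδ1 : δ < 1) (hδm : δ < m) (hδt : δ < b / m) :
    ∃ κ₁ > 0, ∀ κ, 0 < κ → κ ≤ κ₁ → ∃ α t l, 0 < l ∧ |α - 1| ≤ δ ∧ |t - b / m| ≤ δ ∧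
      |slopeInt ρ γ α √(l * t) l - m| ≤ δ ∧ ReducedSystem ρ γ κ α √(l * t) l := by
  have cA := hρ.continuous_corrInt γ
  have cB := hρ.continuous_energyInt γ
  have cC := hρ.continuous_slopeInt γ
  obtain ⟨l₁, hl₁, hex⟩ := hρ.exists_reduced_of_small_prox_parameter hγ hm hb (hδ.trans hδm) hδ hδ1 hδt
  set t₀ := b / m
  have hsys : ∀ l α t, 0 < l → 0 < t → corrInt ρ γ α √(l * t) l = 0 →
      t * slopeInt ρ γ α √(l * t) l = energyInt ρ γ α √(l * t) l →
      ReducedSystem ρ γ (l * slopeInt ρ γ α √(l * t) l) α √(l * t) l := by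
    intro l α t hl ht h1 h2
    refine ⟨h1, ?_, rfl⟩
    rw [Real.sq_sqrt (mul_pos hl ht).le, ← h2]
    ring
  have hex' : ∀ l ∈ Set.Ioc 0 l₁, ∃ p : ℝ × ℝ, |p.1 - 1| ≤ δ ∧ |p.2 - t₀| ≤ δ ∧
      corrInt ρ γ p.1 √(l * p.2) l = 0 ∧
      p.2 * slopeInt ρ γ p.1 √(l * p.2) l = energyInt ρ γ p.1 √(l * p.2) l ∧
      |slopeInt ρ γ p.1 √(l * p.2) l - m| ≤ δ := by
    intro l hl
    obtain ⟨α, t, h⟩ := hex l hl.1 hl.2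
    exact ⟨(α, t), h⟩
  choose! p hp1 hp2 hpA hpB hpC using hex'
  have hK : IsCompact (Set.Icc (1 - δ) (1 + δ) ×ˢ Set.Icc (t₀ - δ) (t₀ + δ)) :=
    isCompact_Icc.prod isCompact_Icc
  have hpath : Continuous fun x : ℝ × ℝ × ℝ => (x.2.1, √(x.1 * x.2.2), x.1) := by fun_prop
  have hpc : ContinuousOn p (Set.Ioc 0 l₁) := by
    refine continuousOn_of_unique_mem hK
      (Z := {x : ℝ × ℝ × ℝ | corrInt ρ γ x.2.1 √(x.1 * x.2.2) x.1 = 0} ∩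
        {x : ℝ × ℝ × ℝ | x.2.2 * slopeInt ρ γ x.2.1 √(x.1 * x.2.2) x.1 =
          energyInt ρ γ x.2.1 √(x.1 * x.2.2) x.1}) ?_ ?_ ?_ ?_
    · exact (isClosed_eq (cA.comp hpath) continuous_const).inter
        (isClosed_eq ((by fun_prop : Continuous fun x : ℝ × ℝ × ℝ => x.2.2).mul (cC.comp hpath))
          (cB.comp hpath))
    · intro l hl
      have h1 := abs_le.1 (hp1 l hl)
      have h2 := abs_le.1 (hp2 l hl)
      exact ⟨⟨by linarith, by linarith⟩, ⟨by linarith, by linarith⟩⟩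
    · exact fun l hl => ⟨hpA l hl, hpB l hl⟩
    · rintro l hl ⟨α, t⟩ ⟨-, ht⟩ ⟨hA, hB⟩
      have h2 := abs_le.1 (hp2 l hl)
      have ht0 : 0 < t := by
        have := ht.1
        simp only at this
        linarith
      have hpt0 : 0 < (p l).2 := by linarith
      -- The two values of `κ` may differ here; the order condition holds because `l` is the same.
      obtain ⟨e1, e2, -⟩ := hρ.eq_of_reducedSystem hγ (Real.sqrt_pos.2 (mul_pos hl.1 ht0))
        (Real.sqrt_pos.2 (mul_pos hl.1 hpt0)) hl.1 hl.1 (hsys l α t hl.1 ht0 hA hB)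
        (hsys l _ _ hl.1 hpt0 (hpA l hl) (hpB l hl)) (by simp)
      rw [Real.sqrt_inj (mul_pos hl.1 ht0).le (mul_pos hl.1 hpt0).le] at e2
      exact Prod.ext e1 (mul_left_cancel₀ hl.1.ne' e2)
  have hkc : ContinuousOn (fun l => l * slopeInt ρ γ (p l).1 √(l * (p l).2) l) (Set.Ioc 0 l₁) :=
    continuousOn_id.mul ((cC.comp hpath).comp_continuousOn (continuousOn_id.prodMk hpc))
  have hl₁m : l₁ ∈ Set.Ioc 0 l₁ := ⟨hl₁, le_rfl⟩
  refine ⟨l₁ * slopeInt ρ γ (p l₁).1 √(l₁ * (p l₁).2) l₁, ?_, fun κ hκ hκ1 => ?_⟩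
  · have := (abs_le.1 (hpC l₁ hl₁m)).1
    exact mul_pos hl₁ (by linarith)
  have hmδ : 0 < m + δ := by linarith
  have hl₀ : 0 < min l₁ (κ / (m + δ)) := by positivity
  set l₀ := min l₁ (κ / (m + δ))
  have hl₀m : l₀ ∈ Set.Ioc 0 l₁ := ⟨hl₀, min_le_left _ _⟩
  have hlow : l₀ * slopeInt ρ γ (p l₀).1 √(l₀ * (p l₀).2) l₀ ≤ κ := by
    have h1 := (abs_le.1 (hpC l₀ hl₀m)).2
    calc l₀ * slopeInt ρ γ (p l₀).1 √(l₀ * (p l₀).2) l₀ ≤ l₀ * (m + δ) :=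
          mul_le_mul_of_nonneg_left (by linarith) hl₀.le
      _ ≤ κ := (le_div_iff₀ hmδ).1 (min_le_right _ _)
  obtain ⟨l, hl, hlκ⟩ := intermediate_value_Icc hl₀m.2
    (hkc.mono fun l hl => ⟨hl₀.trans_le hl.1, hl.2⟩) ⟨hlow, hκ1⟩
  have hlm : l ∈ Set.Ioc 0 l₁ := ⟨hl₀.trans_le hl.1, hl.2⟩
  refine ⟨(p l).1, (p l).2, l, hlm.1, hp1 l hlm, hp2 l hlm, hpC l hlm, ?_⟩
  have h2 := abs_le.1 (hp2 l hlm)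
  rw [← hlκ]
  exact hsys l _ _ hlm.1 (by linarith) (hpA l hlm) (hpB l hlm)

/-- For small `κ` the system has a solution close to the predicted limit. -/
lemma exists_solvesSystem_near (hρ : IsActivationLoss ρ) {γ ε : ℝ} (hγ : 0 < γ) (hε : 0 < ε) :
    ∃ κ₁ > 0, ∀ κ, 0 < κ → κ ≤ κ₁ → ∃ α σ l, 0 < α ∧ 0 < σ ∧ 0 < l ∧ SolvesSystem ρ γ κ α σ l ∧
      |α - 1| < ε ∧ |σ - √(sigmaBarSq ρ γ)| < ε ∧ |l / κ - lambdaBar ρ γ| < ε := by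
  have hm0 := hρ.gaussE_deriv_two_pos hγ
  have hb0 := hρ.gaussE_deriv_mul_deriv_neg_pos hγ
  have hm := hρ.slopeInt_one_zero_zero γ
  have hb := hρ.energyInt_one_zero_zero γ
  rw [sigmaBarSq, lambdaBar]
  set m := gaussE γ (fun q => iteratedDeriv 2 ρ q)
  set b := gaussE γ (fun q => deriv ρ q * deriv ρ (-q))
  have hev : ∀ᶠ u : ℝ × ℝ in 𝓝 (b / m, m),
      |√(u.1 / u.2) - √(b / m ^ 2)| < ε ∧ |1 / u.2 - 1 / m| < ε := by
    have c1 : ContinuousAt (fun u : ℝ × ℝ => |√(u.1 / u.2) - √(b / m ^ 2)|) (b / m, m) :=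
      (((continuousAt_fst.div continuousAt_snd hm0.ne').sqrt).sub continuousAt_const).abs
    have c2 : ContinuousAt (fun u : ℝ × ℝ => |1 / u.2 - 1 / m|) (b / m, m) :=
      ((continuousAt_const.div continuousAt_snd hm0.ne').sub continuousAt_const).abs
    have z1 : |√(b / m / m) - √(b / m ^ 2)| < ε := by
      rw [div_div, ← sq, sub_self, abs_zero]
      exact hε
    have z2 : |1 / m - 1 / m| < ε := by
      rw [sub_self, abs_zero]
      exact hε
    exact (c1.eventually (gt_mem_nhds z1)).and (c2.eventually (gt_mem_nhds z2))
  obtain ⟨r, hr0, hr⟩ := Metric.eventually_nhds_iff.1 hev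
  have hbm : 0 < b / m := div_pos hb0 hm0
  set δ := min (min (ε / 2) (r / 2)) (min (1 / 2) (min (m / 2) (b / m / 2))) with hδ
  have hδ0 : 0 < δ := by positivity
  have d1 : δ ≤ ε / 2 := (min_le_left _ _).trans (min_le_left _ _)
  have d2 : δ ≤ r / 2 := (min_le_left _ _).trans (min_le_right _ _)
  have d3 : δ ≤ 1 / 2 := (min_le_right _ _).trans (min_le_left _ _)
  have d4 : δ ≤ m / 2 := (min_le_right _ _).trans ((min_le_right _ _).trans (min_le_left _ _))
  have d5 : δ ≤ b / m / 2 := (min_le_right _ _).trans ((min_le_right _ _).trans (min_le_right _ _))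
  obtain ⟨κ₁, hκ₁, h⟩ := hρ.exists_reduced_of_small hγ hm hb hδ0 (by linarith) (by linarith)
    (by linarith)
  refine ⟨κ₁, hκ₁, fun κ hκ hle => ?_⟩
  obtain ⟨α, t, l, hl, hα, ht, hC, hsys⟩ := h κ hκ hle
  have hκC := hsys.slope
  set C := slopeInt ρ γ α √(l * t) l
  have hα' := abs_le.1 hα
  have ht' := abs_le.1 ht
  have hC' := abs_le.1 hC
  have ht0 : 0 < t := by linarith
  have hC0 : 0 < C := by linarith
  -- From `s² = l t` and `κ = l C` one reads off `σ² = t / C` and `l / κ = 1 / C`.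
  have hs : √κ * √(t / C) = √(l * t) := by
    rw [← Real.sqrt_mul hκ.le, hκC]
    congr 1
    field_simp
  have hlκ : l / κ = 1 / C := by
    rw [hκC]
    field_simp
  have hclose := hr (y := (t, C)) (by
    rw [Prod.dist_eq, Real.dist_eq, Real.dist_eq]
    exact max_lt (by simp only; linarith) (by simp only; linarith))
  refine ⟨α, √(t / C), l, by linarith, Real.sqrt_pos.2 (div_pos ht0 hC0), hl, ?_, by linarith,
    hclose.1, ?_⟩
  · rw [hρ.solvesSystem_iff γ α _ hκ hl, hs]
    exact hsys
  · rw [hlκ]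
    exact hclose.2

lemma solvesSystem_unique (hρ : IsActivationLoss ρ) {γ κ α σ l α' σ' l' : ℝ} (hγ : 0 < γ)
    (hκ : 0 < κ) (hσ : 0 < σ) (hl : 0 < l) (hσ' : 0 < σ') (hl' : 0 < l')
    (h : SolvesSystem ρ γ κ α σ l) (h' : SolvesSystem ρ γ κ α' σ' l') :
    α = α' ∧ σ = σ' ∧ l = l' := by
  rw [hρ.solvesSystem_iff γ _ _ hκ hl] at h
  rw [hρ.solvesSystem_iff γ _ _ hκ hl'] at h'
  have hk := Real.sqrt_pos.2 hκ
  obtain ⟨h1, h2, h3⟩ := hρ.eq_of_reducedSystem hγ (mul_pos hk hσ) (mul_pos hk hσ') hl hl' h h'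
    (by simp)
  exact ⟨h1, mul_left_cancel₀ hk.ne' h2, h3⟩

end IsActivationLoss

/-! ### First-order expansion of `α` -/

/-- The mean value inequality on `[-|t|, |t|]`. Iterating it gives Taylor remainders without
factorials, which suffices here. -/
lemma abs_le_mul_abs_pow_of_deriv {F F' : ℝ → ℝ} {C : ℝ} {n : ℕ}
    (hF : ∀ t, HasDerivAt F (F' t) t) (h0 : F 0 = 0) (hF' : ∀ t, |F' t| ≤ C * |t| ^ n) (t : ℝ) :
    |F t| ≤ C * |t| ^ (n + 1) := by
  have hC : 0 ≤ C := by
    have := (abs_nonneg _).trans (hF' 1)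
    simpa using this
  have h := (convex_Icc (-|t|) |t|).norm_image_sub_le_of_norm_hasDerivWithin_le
    (f := F) (f' := F') (C := C * |t| ^ n) (x := 0) (y := t)
    (fun x _ => (hF x).hasDerivWithinAt)
    (fun x hx => (hF' x).trans (mul_le_mul_of_nonneg_left
      (pow_le_pow_left₀ (abs_nonneg _) (abs_le.2 hx) n) hC))
    ⟨by simp, abs_nonneg t⟩ ⟨neg_abs_le t, le_abs_self t⟩
  simpa [h0, pow_succ, mul_assoc] using h

namespace IsActivationLoss

variable {ρ : ℝ → ℝ}

lemma abs_deriv_taylor_one_le (hρ : IsActivationLoss ρ) {M : ℝ}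
    (hM : ∀ x, |iteratedDeriv 3 ρ x| ≤ M) (x d : ℝ) :
    |deriv ρ (x + d) - deriv ρ x - iteratedDeriv 2 ρ x * d| ≤ M * |d| ^ 2 := by
  have h1 : ∀ t, |iteratedDeriv 2 ρ (x + t) - iteratedDeriv 2 ρ x| ≤ M * |t| ^ (0 + 1) := by
    refine abs_le_mul_abs_pow_of_deriv (F' := fun t => iteratedDeriv 3 ρ (x + t))
      (fun t => ?_) (by simp) (fun t => by simpa using hM (x + t))
    exact ((hρ.hasDerivAt_iteratedDeriv (k := 2) (by norm_num) (x + t)).comp_const_add x t).sub_const _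
  refine abs_le_mul_abs_pow_of_deriv (n := 1)
    (F := fun t => deriv ρ (x + t) - deriv ρ x - iteratedDeriv 2 ρ x * t)
    (F' := fun t => iteratedDeriv 2 ρ (x + t) - iteratedDeriv 2 ρ x)
    (fun t => ?_) (by simp) h1 d
  refine ((((hρ.hasDerivAt_deriv (x + t)).comp_const_add x t).sub_const _).sub
    ((hasDerivAt_id t).const_mul (iteratedDeriv 2 ρ x))).congr_deriv ?_
  ring

lemma abs_deriv_taylor_two_le (hρ : IsActivationLoss ρ) {M : ℝ}
    (hM : ∀ x, |iteratedDeriv 4 ρ x| ≤ M) (x d : ℝ) :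
    |deriv ρ (x + d) - deriv ρ x - iteratedDeriv 2 ρ x * d - iteratedDeriv 3 ρ x * (d ^ 2 / 2)| ≤
      M * |d| ^ 3 := by
  have h1 : ∀ t, |iteratedDeriv 3 ρ (x + t) - iteratedDeriv 3 ρ x| ≤ M * |t| ^ (0 + 1) := by
    refine abs_le_mul_abs_pow_of_deriv (F' := fun t => iteratedDeriv 4 ρ (x + t))
      (fun t => ?_) (by simp) (fun t => by simpa using hM (x + t))
    exact ((hρ.hasDerivAt_iteratedDeriv (k := 3) (by norm_num) (x + t)).comp_const_add x t).sub_const _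
  have h2 : ∀ t, |iteratedDeriv 2 ρ (x + t) - iteratedDeriv 2 ρ x - iteratedDeriv 3 ρ x * t| ≤
      M * |t| ^ (1 + 1) := by
    refine abs_le_mul_abs_pow_of_deriv
      (F' := fun t => iteratedDeriv 3 ρ (x + t) - iteratedDeriv 3 ρ x) (fun t => ?_) (by simp) h1
    refine ((((hρ.hasDerivAt_iteratedDeriv (k := 2) (by norm_num) (x + t)).comp_const_add
      x t).sub_const _).sub ((hasDerivAt_id t).const_mul (iteratedDeriv 3 ρ x))).congr_deriv ?_
    ring
  refine abs_le_mul_abs_pow_of_deriv (n := 2)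
    (F := fun t => deriv ρ (x + t) - deriv ρ x - iteratedDeriv 2 ρ x * t -
      iteratedDeriv 3 ρ x * (t ^ 2 / 2))
    (F' := fun t => iteratedDeriv 2 ρ (x + t) - iteratedDeriv 2 ρ x - iteratedDeriv 3 ρ x * t)
    (fun t => ?_) (by simp) h2 d
  refine (((((hρ.hasDerivAt_deriv (x + t)).comp_const_add x t).sub_const _).sub
    ((hasDerivAt_id t).const_mul (iteratedDeriv 2 ρ x))).sub
    (((hasDerivAt_pow 2 t).div_const 2).const_mul (iteratedDeriv 3 ρ x))).congr_deriv ?_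
  push_cast
  ring

/-- Multiplying an even function by the activation halves its Gaussian mean. -/
lemma gaussE_deriv_mul_of_even (hρ : IsActivationLoss ρ) (γ C : ℝ) {g : ℝ → ℝ}
    (hg : Continuous g) (hb : ∀ q, |g q| ≤ C * (1 + q ^ 2)) (heven : ∀ q, g (-q) = g q) :
    gaussE γ (fun q => deriv ρ q * g q) = gaussE γ g / 2 := by
  have c1 := hρ.continuous_deriv
  have i0 : ∀ F : ℝ → ℝ, Continuous F → (∀ q, |F q| ≤ C * (1 + q ^ 2)) →
      Integrable F (gaussianReal 0 (Real.toNNReal (γ ^ 2))) := fun F hF hF' =>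
    (((integrable_const 1).add (integrable_sq_gaussianReal _ _)).const_mul C).mono'
      hF.aestronglyMeasurable (Eventually.of_forall hF')
  have hb' : ∀ a q, |deriv ρ a * g q| ≤ C * (1 + q ^ 2) := by
    intro a q
    rw [abs_mul]
    exact (mul_le_of_le_one_left (abs_nonneg _) (hρ.abs_deriv_le_one a)).trans (hb q)
  have h1 := gaussE_comp_neg γ (fun q => deriv ρ q * g q)
  simp only [heven] at h1
  have h2 : gaussE γ (fun q => deriv ρ q * g q) + gaussE γ (fun q => deriv ρ (-q) * g q) =
      gaussE γ g := by
    unfold gaussE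
    rw [← integral_add (i0 _ (by fun_prop) fun q => hb' q q)
      (i0 _ (by fun_prop) fun q => hb' (-q) q)]
    congr 1
    ext q
    rw [hρ.deriv_neg]
    ring
  linarith

lemma corrInt_zero_zero (hρ : IsActivationLoss ρ) (γ α : ℝ) :
    corrInt ρ γ α 0 0 = ∫ x : ℝ × ℝ, deriv ρ x.1 * (x.1 * deriv ρ (-α * x.1)) ∂gaussPair γ := by
  rw [corrInt]
  simp only [hρ.envGrad_zero, zero_mul, add_zero]

/-- Differentiation under the integral; at `α = 1` the weight `ρ'` multiplies an even function and
so halves its mean. -/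
lemma hasDerivAt_corrInt_zero_zero (hρ : IsActivationLoss ρ) (γ : ℝ) :
    HasDerivAt (fun α => corrInt ρ γ α 0 0)
      (-(gaussE γ (fun q => q ^ 2 * iteratedDeriv 2 ρ q) / 2)) 1 := by
  obtain ⟨M, hM0, hM⟩ := hρ.exists_bound_two
  have c1 := hρ.continuous_deriv
  have c2 := hρ.continuous_deriv_two
  have hi : Integrable (fun x : ℝ × ℝ => deriv ρ x.1 * (x.1 * deriv ρ (-1 * x.1)))
      (gaussPair γ) := by
    have := hρ.integrable_corr γ 1 0 0
    simpa only [hρ.envGrad_zero, zero_mul, add_zero] using this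
  have h := (hasDerivAt_integral_of_dominated_loc_of_deriv_le (μ := gaussPair γ) (x₀ := (1 : ℝ))
    (s := Set.univ)
    (F := fun α (x : ℝ × ℝ) => deriv ρ x.1 * (x.1 * deriv ρ (-α * x.1)))
    (F' := fun α (x : ℝ × ℝ) =>
      deriv ρ x.1 * (x.1 * (iteratedDeriv 2 ρ (-α * x.1) * (-x.1))))
    (bound := fun x => M * ((1 + x.1 ^ 2) * (1 + x.2 ^ 2))) univ_mem
    (Eventually.of_forall fun α => (by fun_prop : Continuous _).aestronglyMeasurable)
    hi ((by fun_prop : Continuous _).aestronglyMeasurable)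
    (Eventually.of_forall fun x α _ => ?_) ((integrable_gaussPair_bound γ).const_mul M)
    (Eventually.of_forall fun x α _ => ?_)).2
  · have e : ∫ x : ℝ × ℝ, deriv ρ x.1 * (x.1 * (iteratedDeriv 2 ρ (-1 * x.1) * (-x.1)))
        ∂gaussPair γ = -(gaussE γ (fun q => q ^ 2 * iteratedDeriv 2 ρ q) / 2) := by
      rw [← hρ.gaussE_deriv_mul_of_even γ M (by fun_prop) (fun q => ?_) (fun q => ?_),
        integral_gaussPair_fst γ
          (fun q => deriv ρ q * (q * (iteratedDeriv 2 ρ (-1 * q) * (-q))))]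
      · unfold gaussE
        rw [← integral_neg]
        congr 1
        ext q
        simp only
        rw [neg_one_mul, hρ.deriv_two_neg]
        ring
      · rw [abs_mul, abs_of_nonneg (sq_nonneg q)]
        nlinarith [hM q, sq_nonneg q]
      · rw [hρ.deriv_two_neg, neg_sq]
    rw [e] at h
    simpa only [hρ.corrInt_zero_zero] using h
  · rw [norm_mul, norm_mul, norm_mul, norm_neg]
    calc ‖deriv ρ x.1‖ * (‖x.1‖ * (‖iteratedDeriv 2 ρ (-α * x.1)‖ * ‖x.1‖))
        ≤ 1 * (‖x.1‖ * (M * ‖x.1‖)) := by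
          gcongr
          · exact hρ.abs_deriv_le_one _
          · exact hM _
      _ = M * (x.1 ^ 2 * 1) := by
          rw [← sq_abs, ← Real.norm_eq_abs]
          ring
      _ ≤ M * ((1 + x.1 ^ 2) * (1 + x.2 ^ 2)) := by
          gcongr
          · linarith
          · linarith [sq_nonneg x.2]
  · have h1 : HasDerivAt (fun α : ℝ => -α * x.1) (-x.1) α := by
      simpa using (hasDerivAt_neg α).mul_const x.1
    exact (((hρ.hasDerivAt_deriv _).comp α h1).const_mul x.1).const_mul (deriv ρ x.1)

/-- The term of first order in `s` does not contribute to the correlation functional. -/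
lemma corrInt_sub_corrInt_zero_zero (hρ : IsActivationLoss ρ) (γ α s l : ℝ) :
    corrInt ρ γ α s l - corrInt ρ γ α 0 0 =
      ∫ x : ℝ × ℝ, deriv ρ x.1 * (x.1 * (envGrad ρ l (-α * x.1 + s * x.2) - deriv ρ (-α * x.1) -
        iteratedDeriv 2 ρ (-α * x.1) * (s * x.2))) ∂gaussPair γ := by
  obtain ⟨M, hM0, hM⟩ := hρ.exists_bound_two
  have c1 := hρ.continuous_deriv
  have c2 := hρ.continuous_deriv_two
  have i1 := hρ.integrable_corr γ α s l
  have i2 : Integrable (fun x : ℝ × ℝ => deriv ρ x.1 * (x.1 * deriv ρ (-α * x.1)))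
      (gaussPair γ) := by
    have := hρ.integrable_corr γ α 0 0
    simpa only [hρ.envGrad_zero, zero_mul, add_zero] using this
  have i3 : Integrable (fun x : ℝ × ℝ =>
      (deriv ρ x.1 * (x.1 * iteratedDeriv 2 ρ (-α * x.1))) * (s * x.2)) (gaussPair γ) := by
    refine integrable_gaussPair_of_le (by fun_prop) (M * |s|) fun x => ?_
    rw [abs_mul, abs_mul, abs_mul, abs_mul]
    calc |deriv ρ x.1| * (|x.1| * |iteratedDeriv 2 ρ (-α * x.1)|) * (|s| * |x.2|)
        ≤ 1 * ((1 + x.1 ^ 2) * M) * (|s| * (1 + x.2 ^ 2)) := by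
          gcongr
          · exact hρ.abs_deriv_le_one _
          · exact abs_le_one_add_sq _
          · exact hM _
          · exact abs_le_one_add_sq _
      _ = M * |s| * ((1 + x.1 ^ 2) * (1 + x.2 ^ 2)) := by ring
  have h3 : ∫ x : ℝ × ℝ, (deriv ρ x.1 * (x.1 * iteratedDeriv 2 ρ (-α * x.1))) * (s * x.2)
      ∂gaussPair γ = 0 := by
    rw [integral_gaussPair_mul γ (fun q => deriv ρ q * (q * iteratedDeriv 2 ρ (-α * q)))
      (fun z => s * z), integral_const_mul, integral_id_gaussianReal]
    ring
  have i12 : Integrable (fun x : ℝ × ℝ =>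
      deriv ρ x.1 * (x.1 * envGrad ρ l (-α * x.1 + s * x.2)) -
        deriv ρ x.1 * (x.1 * deriv ρ (-α * x.1))) (gaussPair γ) := i1.sub i2
  rw [hρ.corrInt_zero_zero, corrInt, ← integral_sub i1 i2, ← sub_zero (∫ _, _ ∂_), ← h3,
    ← integral_sub i12 i3]
  congr 1
  ext x
  ring

/-- The envelope gradient solves `H = ρ'(x + d)` with `x = -a q` and `d = √κ σ z - lam H`. In the
second-order Taylor formula at `x`, `d² / κ → σ₀² z²`, the cubic remainder is `o(κ)`, and `-lam H`
contributes the `l₀` term. -/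
lemma tendsto_expansion_integrand (hρ : IsActivationLoss ρ) {a σ lam : ℝ → ℝ} {σ₀ l₀ : ℝ}
    (ha : Tendsto a (𝓝[>] 0) (𝓝 1)) (hσ : Tendsto σ (𝓝[>] 0) (𝓝 σ₀))
    (hl : Tendsto (fun κ => lam κ / κ) (𝓝[>] 0) (𝓝 l₀))
    (hpos : ∀ᶠ κ in 𝓝[>] (0 : ℝ), 0 < lam κ) (q z : ℝ) :
    Tendsto (fun κ => (envGrad ρ (lam κ) (-a κ * q + √κ * σ κ * z) - deriv ρ (-a κ * q) -
        iteratedDeriv 2 ρ (-a κ * q) * (√κ * σ κ * z)) / κ) (𝓝[>] 0)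
      (𝓝 (iteratedDeriv 3 ρ (-q) * (σ₀ ^ 2 * z ^ 2 / 2) -
        l₀ * (iteratedDeriv 2 ρ (-q) * deriv ρ (-q)))) := by
  obtain ⟨M, hM⟩ := hρ.bounded 4 (by norm_num) (by norm_num)
  have hκ0 : Tendsto (fun κ : ℝ => κ) (𝓝[>] 0) (𝓝 0) := tendsto_id.mono_left nhdsWithin_le_nhds
  have hsq : Tendsto (fun κ : ℝ => √κ) (𝓝[>] 0) (𝓝 0) := by
    have := (Real.continuous_sqrt.tendsto 0).comp hκ0
    simpa [Function.comp_def] using this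
  have hev0 : ∀ᶠ κ : ℝ in 𝓝[>] 0, 0 < κ := self_mem_nhdsWithin
  have hlam : Tendsto lam (𝓝[>] 0) (𝓝 0) := by
    have := hl.mul hκ0
    rw [mul_zero] at this
    refine this.congr' ?_
    filter_upwards [hev0] with κ hκ
    exact div_mul_cancel₀ _ hκ.ne'
  have hx : Tendsto (fun κ => -a κ * q) (𝓝[>] 0) (𝓝 (-q)) := by
    have := ha.neg.mul_const q
    rwa [neg_one_mul] at this
  have hsz : Tendsto (fun κ => √κ * σ κ * z) (𝓝[>] 0) (𝓝 0) := by
    have := (hsq.mul hσ).mul_const z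
    rwa [zero_mul, zero_mul] at this
  have hH : Tendsto (fun κ => envGrad ρ (lam κ) (-a κ * q + √κ * σ κ * z)) (𝓝[>] 0)
      (𝓝 (deriv ρ (-q))) := by
    have h1 := (hρ.continuous_envGrad_uncurry.tendsto (0, -q + 0)).comp
      (hlam.prodMk_nhds (hx.add hsz))
    simpa only [hρ.envGrad_zero, add_zero, Function.comp_def] using h1
  set H := fun κ => envGrad ρ (lam κ) (-a κ * q + √κ * σ κ * z) with hHdef
  set d := fun κ => √κ * σ κ * z - lam κ * H κ with hd
  have hd0 : Tendsto d (𝓝[>] 0) (𝓝 0) := by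
    have := hsz.sub (hlam.mul hH)
    simpa using this
  have hd2 : Tendsto (fun κ => d κ ^ 2 / κ) (𝓝[>] 0) (𝓝 (σ₀ ^ 2 * z ^ 2)) := by
    have h1 : Tendsto (fun κ => (σ κ * z - lam κ / κ * √κ * H κ) ^ 2) (𝓝[>] 0)
        (𝓝 ((σ₀ * z - l₀ * 0 * deriv ρ (-q)) ^ 2)) :=
      ((hσ.mul_const z).sub ((hl.mul hsq).mul hH)).pow 2
    have e : (σ₀ * z - l₀ * 0 * deriv ρ (-q)) ^ 2 = σ₀ ^ 2 * z ^ 2 := by ring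
    rw [e] at h1
    refine h1.congr' ?_
    filter_upwards [hev0] with κ hκ
    have hk : √κ ≠ 0 := (Real.sqrt_pos.2 hκ).ne'
    have hk2 : κ = √κ ^ 2 := (Real.sq_sqrt hκ.le).symm
    have e2 : d κ = √κ * (σ κ * z - lam κ / κ * √κ * H κ) := by
      rw [hd]
      simp only
      have : lam κ / κ * √κ * √κ = lam κ := by
        rw [mul_assoc, ← sq, ← hk2, div_mul_cancel₀ _ hκ.ne']
      linear_combination (H κ) * this
    rw [e2, mul_pow, ← hk2, mul_div_cancel_left₀ _ hκ.ne']
  have hrem : Tendsto (fun κ => (deriv ρ (-a κ * q + d κ) - deriv ρ (-a κ * q) -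
      iteratedDeriv 2 ρ (-a κ * q) * d κ - iteratedDeriv 3 ρ (-a κ * q) * (d κ ^ 2 / 2)) / κ)
      (𝓝[>] 0) (𝓝 0) := by
    have hb : Tendsto (fun κ => M * (d κ ^ 2 / κ * |d κ|)) (𝓝[>] 0) (𝓝 0) := by
      have := (hd2.mul hd0.abs).const_mul M
      simpa using this
    refine squeeze_zero_norm' ?_ hb
    filter_upwards [hev0] with κ hκ
    rw [norm_div, Real.norm_eq_abs, Real.norm_eq_abs, abs_of_pos hκ, div_le_iff₀ hκ]
    refine (hρ.abs_deriv_taylor_two_le hM _ _).trans_eq ?_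
    rw [← sq_abs (d κ)]
    field_simp
  have h3 : Tendsto (fun κ => iteratedDeriv 3 ρ (-a κ * q)) (𝓝[>] 0)
      (𝓝 (iteratedDeriv 3 ρ (-q))) := (hρ.continuous_deriv_three.tendsto _).comp hx
  have h2 : Tendsto (fun κ => iteratedDeriv 2 ρ (-a κ * q)) (𝓝[>] 0)
      (𝓝 (iteratedDeriv 2 ρ (-q))) := (hρ.continuous_deriv_two.tendsto _).comp hx
  have hlim := (hrem.add (h3.mul (hd2.div_const 2))).sub (hl.mul (h2.mul hH))
  rw [zero_add] at hlim
  refine hlim.congr' ?_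
  filter_upwards [hev0, hpos] with κ hκ hlκ
  have hp : -a κ * q + d κ = prox |lam κ| ρ (-a κ * q + √κ * σ κ * z) := by
    rw [hρ.prox_abs_eq_sub, hd, abs_of_pos hlκ]
    ring
  have hHe : deriv ρ (-a κ * q + d κ) = H κ := by
    rw [hp, hHdef]
    rfl
  have hHκ : envGrad ρ (lam κ) (-a κ * q + √κ * σ κ * z) = H κ := rfl
  rw [hHe, hHκ, hd]
  simp only
  generalize H κ = y
  field_simp
  ring

/-- Uniform domination for the limit above. A first-order Taylor formula is enough, since `d²` and
`l` are both of order `κ`. -/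
lemma abs_expansion_integrand_le (hρ : IsActivationLoss ρ) {M N S Λ κ a σ l : ℝ}
    (hM : ∀ x, |iteratedDeriv 2 ρ x| ≤ M) (hN : ∀ x, |iteratedDeriv 3 ρ x| ≤ N) (hκ : 0 < κ)
    (hκ1 : κ ≤ 1) (hl : 0 < l) (hσ : σ ^ 2 ≤ S) (hlΛ : l / κ ≤ Λ) (q z : ℝ) :
    |(envGrad ρ l (-a * q + √κ * σ * z) - deriv ρ (-a * q) -
        iteratedDeriv 2 ρ (-a * q) * (√κ * σ * z)) / κ| ≤
      (2 * N * (S + Λ ^ 2) + M * Λ) * (1 + z ^ 2) := by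
  have hM0 : 0 ≤ M := (abs_nonneg _).trans (hM 0)
  have hN0 : 0 ≤ N := (abs_nonneg _).trans (hN 0)
  have hS0 : 0 ≤ S := (sq_nonneg _).trans hσ
  have hΛ0 : 0 ≤ Λ := (div_pos hl hκ).le.trans hlΛ
  have hlκ : l ≤ Λ * κ := (div_le_iff₀ hκ).1 hlΛ
  set H := envGrad ρ l (-a * q + √κ * σ * z) with hH
  have hH0 : 0 ≤ H := hρ.envGrad_nonneg _ _
  have hH1 : H ≤ 1 := hρ.envGrad_le_one _ _
  have hHe : deriv ρ (-a * q + (√κ * σ * z - l * H)) = H := by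
    have h1 : -a * q + (√κ * σ * z - l * H) = prox |l| ρ (-a * q + √κ * σ * z) := by
      rw [hρ.prox_abs_eq_sub, abs_of_pos hl]
      ring
    rw [h1]
    rfl
  have ht := hρ.abs_deriv_taylor_one_le hN (-a * q) (√κ * σ * z - l * H)
  rw [hHe, sq_abs] at ht
  have hlH : l * H ≤ Λ * κ := by nlinarith
  have hlH2 : (l * H) ^ 2 ≤ Λ ^ 2 * κ := by
    have h1 : (l * H) ^ 2 ≤ (Λ * κ) ^ 2 := pow_le_pow_left₀ (by positivity) hlH 2
    have h2 : (Λ * κ) ^ 2 ≤ Λ ^ 2 * κ := by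
      rw [mul_pow]
      exact mul_le_mul_of_nonneg_left (by nlinarith) (sq_nonneg _)
    linarith
  have hd : (√κ * σ * z - l * H) ^ 2 ≤ κ * (2 * (S + Λ ^ 2) * (1 + z ^ 2)) := by
    have h1 : (√κ * σ * z) ^ 2 = κ * (σ ^ 2 * z ^ 2) := by
      rw [mul_pow, mul_pow, Real.sq_sqrt hκ.le]
      ring
    have h2 : (√κ * σ * z - l * H) ^ 2 ≤ 2 * (√κ * σ * z) ^ 2 + 2 * (l * H) ^ 2 := by
      nlinarith [sq_nonneg (√κ * σ * z + l * H)]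
    have h3 : σ ^ 2 * z ^ 2 ≤ S * z ^ 2 := mul_le_mul_of_nonneg_right hσ (sq_nonneg z)
    have h4 := mul_le_mul_of_nonneg_left h3 hκ.le
    have h5 : 0 ≤ κ * (Λ ^ 2 * z ^ 2) := by positivity
    have h6 : 0 ≤ κ * S := by positivity
    rw [h1] at h2
    nlinarith
  rw [abs_div, abs_of_pos hκ, div_le_iff₀ hκ]
  have e : H - deriv ρ (-a * q) - iteratedDeriv 2 ρ (-a * q) * (√κ * σ * z) =
      (H - deriv ρ (-a * q) - iteratedDeriv 2 ρ (-a * q) * (√κ * σ * z - l * H)) -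
        iteratedDeriv 2 ρ (-a * q) * (l * H) := by ring
  have h7 : |iteratedDeriv 2 ρ (-a * q) * (l * H)| ≤ M * (Λ * κ) := by
    rw [abs_mul, abs_of_nonneg (mul_nonneg hl.le hH0)]
    exact mul_le_mul (hM _) hlH (by positivity) hM0
  rw [e]
  calc _ ≤ |H - deriv ρ (-a * q) - iteratedDeriv 2 ρ (-a * q) * (√κ * σ * z - l * H)| +
        |iteratedDeriv 2 ρ (-a * q) * (l * H)| := abs_sub _ _
    _ ≤ N * (κ * (2 * (S + Λ ^ 2) * (1 + z ^ 2))) + M * (Λ * κ) * (1 + z ^ 2) := by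
        refine add_le_add (ht.trans (mul_le_mul_of_nonneg_left hd hN0)) (h7.trans ?_)
        exact le_mul_of_one_le_right (by positivity) (by linarith [sq_nonneg z])
    _ = _ := by ring

lemma tendsto_corrInt_sub_div (hρ : IsActivationLoss ρ) {γ : ℝ} {a σ lam : ℝ → ℝ} {σ₀ l₀ : ℝ}
    (ha : Tendsto a (𝓝[>] 0) (𝓝 1)) (hσ : Tendsto σ (𝓝[>] 0) (𝓝 σ₀))
    (hl : Tendsto (fun κ => lam κ / κ) (𝓝[>] 0) (𝓝 l₀))
    (hpos : ∀ᶠ κ in 𝓝[>] (0 : ℝ), 0 < lam κ) :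
    Tendsto (fun κ => (corrInt ρ γ (a κ) (√κ * σ κ) (lam κ) - corrInt ρ γ (a κ) 0 0) / κ) (𝓝[>] 0)
      (𝓝 (-(σ₀ ^ 2 * gaussE γ (fun q => q * iteratedDeriv 3 ρ q) / 4))) := by
  obtain ⟨M, hM0, hM⟩ := hρ.exists_bound_two
  obtain ⟨N, hN0, hN⟩ := hρ.exists_bound_three
  have c1 := hρ.continuous_deriv
  have c2 := hρ.continuous_deriv_two
  have c3 := hρ.continuous_deriv_three
  set K := 2 * N * (σ₀ ^ 2 + 1 + (l₀ + 1) ^ 2) + M * (l₀ + 1) with hK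
  have hlim : Tendsto (fun κ => ∫ x : ℝ × ℝ, deriv ρ x.1 * (x.1 *
      ((envGrad ρ (lam κ) (-a κ * x.1 + √κ * σ κ * x.2) - deriv ρ (-a κ * x.1) -
        iteratedDeriv 2 ρ (-a κ * x.1) * (√κ * σ κ * x.2)) / κ)) ∂gaussPair γ) (𝓝[>] 0)
      (𝓝 (∫ x : ℝ × ℝ, deriv ρ x.1 * (x.1 * (iteratedDeriv 3 ρ (-x.1) * (σ₀ ^ 2 * x.2 ^ 2 / 2) -
        l₀ * (iteratedDeriv 2 ρ (-x.1) * deriv ρ (-x.1)))) ∂gaussPair γ)) := by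
    refine tendsto_integral_filter_of_dominated_convergence
      (fun x => K * ((1 + x.1 ^ 2) * (1 + x.2 ^ 2))) (Eventually.of_forall fun κ => ?_) ?_
      ((integrable_gaussPair_bound γ).const_mul K) (Eventually.of_forall fun x => ?_)
    · have := hρ.continuous_envGrad (lam κ)
      exact (by fun_prop : Continuous _).aestronglyMeasurable
    · have e1 : ∀ᶠ κ : ℝ in 𝓝[>] 0, κ ≤ 1 := by
        filter_upwards [Ioc_mem_nhdsGT (zero_lt_one' ℝ)] with κ hκ using hκ.2
      have e2 : ∀ᶠ κ : ℝ in 𝓝[>] 0, σ κ ^ 2 ≤ σ₀ ^ 2 + 1 :=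
        (hσ.pow 2).eventually (ge_mem_nhds (by linarith))
      have e3 : ∀ᶠ κ : ℝ in 𝓝[>] 0, lam κ / κ ≤ l₀ + 1 :=
        hl.eventually (ge_mem_nhds (by linarith))
      filter_upwards [e1, e2, e3, hpos, self_mem_nhdsWithin] with κ h1 h2 h3 h4 h5
      refine Eventually.of_forall fun x => ?_
      have hb := hρ.abs_expansion_integrand_le hM hN h5 h1 h4 h2 h3 (a := a κ) x.1 x.2
      rw [norm_mul, norm_mul]
      calc _ ≤ 1 * ((1 + x.1 ^ 2) * (K * (1 + x.2 ^ 2))) := by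
            gcongr
            · exact hρ.abs_deriv_le_one _
            · exact abs_le_one_add_sq _
            · exact hb
        _ = _ := by ring
    · exact ((hρ.tendsto_expansion_integrand ha hσ hl hpos x.1 x.2).const_mul x.1).const_mul _
  have hval : ∫ x : ℝ × ℝ, deriv ρ x.1 * (x.1 * (iteratedDeriv 3 ρ (-x.1) *
      (σ₀ ^ 2 * x.2 ^ 2 / 2) - l₀ * (iteratedDeriv 2 ρ (-x.1) * deriv ρ (-x.1)))) ∂gaussPair γ =
      -(σ₀ ^ 2 * gaussE γ (fun q => q * iteratedDeriv 3 ρ q) / 4) := by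
    have i1 : Integrable (fun x : ℝ × ℝ => deriv ρ x.1 * (x.1 * iteratedDeriv 3 ρ x.1) *
        (-(σ₀ ^ 2 / 2) * x.2 ^ 2)) (gaussPair γ) := by
      refine integrable_gaussPair_of_le (by fun_prop) (N * |-(σ₀ ^ 2 / 2)|) fun x => ?_
      rw [abs_mul, abs_mul, abs_mul, abs_mul, abs_of_nonneg (sq_nonneg x.2)]
      calc _ ≤ 1 * ((1 + x.1 ^ 2) * N) * (|-(σ₀ ^ 2 / 2)| * (1 + x.2 ^ 2)) := by
            gcongr
            · exact hρ.abs_deriv_le_one _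
            · exact abs_le_one_add_sq _
            · exact hN _
            · linarith
        _ = _ := by ring
    have i2 : Integrable (fun x : ℝ × ℝ => deriv ρ x.1 *
        (x.1 * (l₀ * (iteratedDeriv 2 ρ (-x.1) * deriv ρ (-x.1))))) (gaussPair γ) := by
      refine integrable_gaussPair_of_le (by fun_prop) (|l₀| * M) fun x => ?_
      rw [abs_mul, abs_mul, abs_mul, abs_mul]
      calc _ ≤ 1 * ((1 + x.1 ^ 2) * (|l₀| * (M * 1))) := by
            gcongr
            · exact hρ.abs_deriv_le_one _
            · exact abs_le_one_add_sq _
            · exact hM _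
            · exact hρ.abs_deriv_le_one _
        _ = |l₀| * M * ((1 + x.1 ^ 2) * 1) := by ring
        _ ≤ _ := by
            gcongr
            linarith [sq_nonneg x.2]
    -- The integrand is odd because `ρ'(q) ρ'(-q)` and `ρ''` are even, so `l₀` drops out of the
    -- expansion.
    have h2 : ∫ x : ℝ × ℝ, deriv ρ x.1 *
        (x.1 * (l₀ * (iteratedDeriv 2 ρ (-x.1) * deriv ρ (-x.1)))) ∂gaussPair γ = 0 := by
      rw [integral_gaussPair_fst γ
        (fun q => deriv ρ q * (q * (l₀ * (iteratedDeriv 2 ρ (-q) * deriv ρ (-q)))))]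
      refine gaussE_eq_zero_of_odd γ fun q => ?_
      rw [neg_neg, hρ.deriv_two_neg]
      ring
    have h1 : ∫ x : ℝ × ℝ, deriv ρ x.1 * (x.1 * iteratedDeriv 3 ρ x.1) *
        (-(σ₀ ^ 2 / 2) * x.2 ^ 2) ∂gaussPair γ =
        -(σ₀ ^ 2 * gaussE γ (fun q => q * iteratedDeriv 3 ρ q) / 4) := by
      rw [integral_gaussPair_mul γ (fun q => deriv ρ q * (q * iteratedDeriv 3 ρ q))
        (fun z => -(σ₀ ^ 2 / 2) * z ^ 2), integral_const_mul, integral_sq_gaussianReal_one,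
        hρ.gaussE_deriv_mul_of_even γ N (by fun_prop) (fun q => ?_) (fun q => ?_)]
      · ring
      · rw [abs_mul, mul_comm]
        exact mul_le_mul (hN q) (abs_le_one_add_sq q) (abs_nonneg _) hN0
      · rw [hρ.deriv_three_neg]
        ring
    rw [← h1, ← sub_zero (∫ x : ℝ × ℝ, deriv ρ x.1 * (x.1 * iteratedDeriv 3 ρ x.1) *
        (-(σ₀ ^ 2 / 2) * x.2 ^ 2) ∂gaussPair γ), ← h2, ← integral_sub i1 i2]
    congr 1
    ext x
    rw [hρ.deriv_three_neg]
    ring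
  rw [hval] at hlim
  refine hlim.congr fun κ => ?_
  rw [hρ.corrInt_sub_corrInt_zero_zero, ← integral_div]
  congr 1
  ext x
  ring

lemma tendsto_alpha_sub_one_div (hρ : IsActivationLoss ρ) {γ : ℝ} (hγ : 0 < γ)
    {a σ lam : ℝ → ℝ} (ha : Tendsto a (𝓝[>] 0) (𝓝 1))
    (hσ : Tendsto σ (𝓝[>] 0) (𝓝 √(sigmaBarSq ρ γ)))
    (hl : Tendsto (fun κ => lam κ / κ) (𝓝[>] 0) (𝓝 (lambdaBar ρ γ)))
    (hpos : ∀ᶠ κ in 𝓝[>] (0 : ℝ), 0 < lam κ)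
    (hcorr : ∀ᶠ κ in 𝓝[>] (0 : ℝ), corrInt ρ γ (a κ) (√κ * σ κ) (lam κ) = 0) :
    Tendsto (fun κ => (a κ - 1) / κ) (𝓝[>] 0) (𝓝 (alphaBar ρ γ)) := by
  have hE := hρ.gaussE_sq_mul_deriv_two_pos hγ
  have hm := hρ.gaussE_deriv_two_pos hγ
  have hb := hρ.gaussE_deriv_mul_deriv_neg_pos hγ
  have hder := hρ.hasDerivAt_corrInt_zero_zero γ
  -- Factoring `A(α, 0, 0)` as `α - 1` times its slope requires only `a → 1`, with no prior rate.
  have hsl : Tendsto (fun κ => dslope (fun α => corrInt ρ γ α 0 0) 1 (a κ)) (𝓝[>] 0)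
      (𝓝 (-(gaussE γ (fun q => q ^ 2 * iteratedDeriv 2 ρ q) / 2))) := by
    have h1 := (continuousAt_dslope_same.2 hder.differentiableAt).tendsto.comp ha
    rwa [dslope_same, hder.deriv] at h1
  have hlim := hρ.tendsto_corrInt_sub_div (γ := γ) ha hσ hl hpos
  have hne : -(gaussE γ (fun q => q ^ 2 * iteratedDeriv 2 ρ q) / 2) ≠ 0 :=
    (neg_neg_of_pos (half_pos hE)).ne
  have hquot := hlim.div hsl hne
  have hval : -(√(sigmaBarSq ρ γ) ^ 2 * gaussE γ (fun q => q * iteratedDeriv 3 ρ q) / 4) /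
      -(gaussE γ (fun q => q ^ 2 * iteratedDeriv 2 ρ q) / 2) = -alphaBar ρ γ := by
    rw [Real.sq_sqrt (by unfold sigmaBarSq; positivity), sigmaBarSq, alphaBar]
    field_simp
    ring
  have h2 := hquot
  rw [hval] at h2
  have h3 := h2.neg
  rw [neg_neg] at h3
  refine h3.congr' ?_
  filter_upwards [hcorr, self_mem_nhdsWithin, hsl.eventually_ne hne] with κ h4 h5 h6
  have h7 := sub_smul_dslope (fun α => corrInt ρ γ α 0 0) 1 (a κ)
  simp only [smul_eq_mul, hρ.corrInt_one_zero_zero, sub_zero] at h7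
  simp only [Pi.div_apply]
  rw [h4, ← h7]
  have h8 : κ ≠ 0 := (show (0 : ℝ) < κ from h5).ne'
  field_simp
  ring

end IsActivationLoss

/-! ### Conclusion -/

theorem mainTheorem2 (ρ : ℝ → ℝ) (hρ : IsActivationLoss ρ) (γ : ℝ) (hγ : 0 < γ) :
    0 < gaussE γ (fun q => q ^ 2 * iteratedDeriv 2 ρ q) ∧
    0 < sigmaBarSq ρ γ ∧ 0 < lambdaBar ρ γ ∧
    ∃ κ₀ : ℝ, 0 < κ₀ ∧ ∃ αs σs lams : ℝ → ℝ,
      (∀ κ : ℝ, 0 < κ → κ ≤ κ₀ →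
        (0 < αs κ ∧ 0 < σs κ ∧ 0 < lams κ ∧ SolvesSystem ρ γ κ (αs κ) (σs κ) (lams κ)) ∧
        ∀ α σ lam : ℝ, 0 < α → 0 < σ → 0 < lam → SolvesSystem ρ γ κ α σ lam →
          α = αs κ ∧ σ = σs κ ∧ lam = lams κ) ∧
      (fun κ : ℝ => αs κ - (1 + alphaBar ρ γ * κ)) =o[𝓝[>] 0] (fun κ : ℝ => κ) ∧
      (fun κ : ℝ => σs κ - √(sigmaBarSq ρ γ)) =o[𝓝[>] 0] (fun _ : ℝ => (1 : ℝ)) ∧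
      (fun κ : ℝ => lams κ - lambdaBar ρ γ * κ) =o[𝓝[>] 0] (fun κ : ℝ => κ) := by
  have hm := hρ.gaussE_deriv_two_pos hγ
  have hb := hρ.gaussE_deriv_mul_deriv_neg_pos hγ
  refine ⟨hρ.gaussE_sq_mul_deriv_two_pos hγ, by unfold sigmaBarSq; positivity,
    by unfold lambdaBar; positivity, ?_⟩
  -- The tolerance `1` only fixes `κ₀` and a choice of solutions; by uniqueness these coincide with
  -- the solutions found for any smaller tolerance.
  obtain ⟨κ₀, hκ₀, hex⟩ := hρ.exists_solvesSystem_near hγ one_pos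
  choose! αs σs lams hα hσ hl hsol _ _ _ using hex
  have hnear : ∀ ε > 0, ∀ᶠ κ in 𝓝[>] (0 : ℝ), |αs κ - 1| < ε ∧
      |σs κ - √(sigmaBarSq ρ γ)| < ε ∧ |lams κ / κ - lambdaBar ρ γ| < ε := by
    intro ε hε
    obtain ⟨κ₁, hκ₁, h⟩ := hρ.exists_solvesSystem_near hγ hε
    filter_upwards [Ioc_mem_nhdsGT hκ₀, Ioc_mem_nhdsGT hκ₁] with κ hk0 hk1
    obtain ⟨α, σ, l, -, hσ', hl', hsol', h1, h2, h3⟩ := h κ hk1.1 hk1.2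
    obtain ⟨rfl, rfl, rfl⟩ := hρ.solvesSystem_unique hγ hk0.1 hσ' hl' (hσ κ hk0.1 hk0.2)
      (hl κ hk0.1 hk0.2) hsol' (hsol κ hk0.1 hk0.2)
    exact ⟨h1, h2, h3⟩
  have tα : Tendsto αs (𝓝[>] 0) (𝓝 1) :=
    Metric.tendsto_nhds.2 fun ε hε => (hnear ε hε).mono fun κ h => h.1
  have tσ : Tendsto σs (𝓝[>] 0) (𝓝 √(sigmaBarSq ρ γ)) :=
    Metric.tendsto_nhds.2 fun ε hε => (hnear ε hε).mono fun κ h => h.2.1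
  have tl : Tendsto (fun κ => lams κ / κ) (𝓝[>] 0) (𝓝 (lambdaBar ρ γ)) :=
    Metric.tendsto_nhds.2 fun ε hε => (hnear ε hε).mono fun κ h => h.2.2
  have hpos : ∀ᶠ κ in 𝓝[>] (0 : ℝ), 0 < lams κ := by
    filter_upwards [Ioc_mem_nhdsGT hκ₀] with κ hk using hl κ hk.1 hk.2
  have hcorr : ∀ᶠ κ in 𝓝[>] (0 : ℝ), corrInt ρ γ (αs κ) (√κ * σs κ) (lams κ) = 0 := by
    filter_upwards [Ioc_mem_nhdsGT hκ₀] with κ hk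
    exact ((hρ.solvesSystem_iff γ _ _ hk.1 (hl κ hk.1 hk.2)).1 (hsol κ hk.1 hk.2)).corr
  have hκne : ∀ᶠ κ : ℝ in 𝓝[>] 0, κ ≠ 0 := by
    filter_upwards [self_mem_nhdsWithin] with κ hκ using (show (0 : ℝ) < κ from hκ).ne'
  have of_quotient : ∀ {u v : ℝ → ℝ} {c : ℝ}, Tendsto (fun κ => u κ / κ) (𝓝[>] 0) (𝓝 c) →
      (∀ κ, v κ = u κ - c * κ) → v =o[𝓝[>] 0] (fun κ : ℝ => κ) := by
    intro u v c hu hv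
    rw [isLittleO_iff_tendsto' (hκne.mono fun κ h h0 => absurd h0 h)]
    have h1 := hu.sub_const c
    rw [sub_self] at h1
    refine h1.congr' ?_
    filter_upwards [hκne] with κ hκ
    rw [hv, sub_div, mul_div_cancel_right₀ _ hκ]
  refine ⟨κ₀, hκ₀, αs, σs, lams, fun κ hκ hκ' => ⟨⟨hα κ hκ hκ', hσ κ hκ hκ', hl κ hκ hκ',
    hsol κ hκ hκ'⟩, fun α σ l _ hσ' hl' h => hρ.solvesSystem_unique hγ hκ hσ' hl' (hσ κ hκ hκ')
      (hl κ hκ hκ') h (hsol κ hκ hκ')⟩, ?_, ?_, ?_⟩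
  · exact of_quotient (hρ.tendsto_alpha_sub_one_div hγ tα tσ tl hpos hcorr) fun κ => by ring
  · rw [isLittleO_one_iff]
    simpa using tσ.sub_const √(sigmaBarSq ρ γ)
  · exact of_quotient tl fun κ => rfl
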